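/- **Conventions.** Let $k\ge 2$ be an integer and let $\lambda,\mu$ be infinite cardinals. *Set mappings.* $(\lambda,m,\mu)\to n$ means: for every $F:[\lambda]^m\to[\lambda]^{<\mu}$ with $F(x)\cap x=\emptyset$ for all $x\in[\lambda]^m$ there is $X\subseteq\lambda$ with $|X|=n$ such that $F(x)\cap X=\emptyset$ for every $x\in[X]^m$. *The Boolean algebra.* $\mathfrak B^0_{\alpha,\mu}$ is the Boolean algebra generated by $\alpha$ independent partitions of $1$ into $\mu$ pieces: it is generated by elements $\mathbf x_f$, for $f$ a finite partial function from $\alpha$ to $\mu$, with $\mathbf x_f\le\mathbf x_g$ if $f\supseteq g$, and $\mathbf x_f\cap\mathbf x_g\ne 0$ iff $f,g$ are compatible; concretely, it is the algebra of subsets of ${}^{\alpha}\mu$ generated by the sets $\mathbf x_f=\{\eta\in{}^\alpha\mu: f\subseteq\eta\}$. $\mathfrak B^1_{\alpha,\mu}$ is its completion. *The theory.* $T_{k+1,k}$ is the model completion of the theory of one symmetric irreflexive $(k+1)$-ary relation $R$ (irreflexive: $R$ holds only of tuples of distinct elements) with no complete graph on $k+2$ vertices. *Morality.* Let $\mathfrak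 B$ be a Boolean algebra, $T$ a theory in a countable language and $\mathcal D_*$ an ultrafilter on $\mathfrak B$. For a sequence $\bar\varphi=\langle\varphi_\alpha(x;\bar y_\alpha):\alpha<\lambda\rangle$ of formulas ($x$ a single variable, $\bar y_\alpha$ a finite tuple), a family $\langle\mathbf b_u:u\in[\lambda]^{<\aleph_0}\rangle$ of nonzero elements of $\mathfrak B$ is a $(\lambda,\mathfrak B,T,\bar\varphi)$-possibility if (1) $v\subseteq u$ implies $\mathbf b_u\le\mathbf b_v$; and (2) whenever $u_*\in[\lambda]^{<\aleph_0}$ and $0\ne\mathbf c\in\mathfrak B$ are such that for every $u\subseteq u_*$ either $\mathbf c\le\mathbf b_u$ or $\mathbf c\le 1-\mathbf b_u$, and $\mathbf c\le\mathbf b_{\{\alpha\}}$ for every $\alpha\in u_*$, there are a model $M\models T$ and tuples $\bar a_\alpha$ from $M$ ($\alpha\in u_*$) such that for every $u\subseteq u_*$: $M\models(\exists x)\bigwedge_{\alpha\in u}\varphi_\alpha(x;\bar a_\alpha)$ iff $\mathbf c\le\mathbf b_u$. The ultrafilter $\mathcal D_*$ is $(\lambda,\mathfrak B,T)$-moral (in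 short, $(\lambda,T)$-moral) if for every sequence $\bar\varphi$ of formulas, every $(\lambda,\mathfrak B,T,\bar\varphi)$-possibility $\langle\mathbf b_u\rangle$ with all $\mathbf b_u\in\mathcal D_*$ has a multiplicative refinement in $\mathcal D_*$, i.e. a family $\langle\mathbf b'_u:u\in[\lambda]^{<\aleph_0}\rangle$ of elements of $\mathcal D_*$ with $\mathbf b'_u\le\mathbf b_u$ and $\mathbf b'_u\cap\mathbf b'_v=\mathbf b'_{u\cup v}$ for all $u,v$. **Claim.** Suppose that $2\le k$ and that either $\mu=\aleph_\alpha$ and $\lambda=\aleph_{\alpha+\ell}$ for some ordinal $\alpha$ and some integer $\ell>k$, or just $(\lambda,k,\mu^+)\to k+1$. Let $\mathfrak B=\mathfrak B^1_{2^\lambda,\mu}$. Then no ultrafilter $\mathcal D_*$ on $\mathfrak B$ is $(\lambda,T_{k+1,k})$-moral. -/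

import Mathlib

universe u v w

namespace MoralHyp
open Cardinal FirstOrder FirstOrder.Language

/-! ### Boolean algebras -/

section Completion

/-- `𝔅⁺`: the nonzero elements of a Boolean algebra, with the induced order. -/
abbrev Positive (B : Type u) [BooleanAlgebra B] : Type u := {b : B // b ≠ ⊥}

/-- The completion of a Boolean algebra `B`: the Boolean algebra of regular lower sets
(`Sᶜᶜ = S` in the Heyting algebra of lower sets) of the partial order `B⁺`. -/
abbrev BoolCompletion (B : Type u) [BooleanAlgebra B] : Type u :=
  Heyting.Regular (LowerSet (Positive B))

variable {B : Type u} [BooleanAlgebra B]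

/-- Membership in the Heyting complement of a lower set. -/
theorem mem_heytingCompl (S : LowerSet (Positive B)) (x : Positive B) :
    x ∈ (Sᶜ : LowerSet (Positive B)) ↔ ∀ y ≤ x, y ∉ S := by
  constructor
  · intro hx y hy hyS
    have h : y ∈ (S ⊓ Sᶜ : LowerSet (Positive B)) := ⟨hyS, Sᶜ.lower hy hx⟩
    rw [inf_compl_self] at h
    exact h
  · intro h
    have : LowerSet.Iic x ≤ Sᶜ := by
      rw [le_compl_iff_disjoint_right, disjoint_iff_inf_le]
      rintro y ⟨hy, hyS⟩
      exact (h y hy hyS).elim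
    exact this (LowerSet.mem_Iic_iff.2 le_rfl)

theorem mem_of_regular (c : BoolCompletion B) (x : Positive B)
    (h : ∀ y ≤ x, ∃ z ≤ y, z ∈ (c : LowerSet (Positive B))) :
    x ∈ (c : LowerSet (Positive B)) := by
  have hc : ((c : LowerSet (Positive B)))ᶜᶜ = c := c.2
  rw [← hc, mem_heytingCompl]
  intro y hy hyc
  obtain ⟨z, hz, hzc⟩ := h y hy
  exact (mem_heytingCompl _ _).1 hyc z hz hzc

/-- The canonical map of a Boolean algebra into its completion. -/
def toCompletion (b : B) : BoolCompletion B :=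
  ⟨⟨{x | x.1 ≤ b}, fun _ _ hyx hx => le_trans hyx hx⟩, by
    refine le_antisymm ?_ le_compl_compl
    intro x hx
    by_contra hxb
    have hxb' : ¬ x.1 ≤ b := hxb
    have hne : x.1 \ b ≠ ⊥ := fun h => hxb' (sdiff_eq_bot_iff.1 h)
    refine (mem_heytingCompl _ _).1 hx ⟨x.1 \ b, hne⟩ sdiff_le ?_
    rw [mem_heytingCompl]
    intro z hz hzb
    have hzb' : z.1 ≤ b := hzb
    have hz' : z.1 ≤ x.1 \ b := hz
    exact z.2 (le_bot_iff.1 ((disjoint_sdiff_self_left : Disjoint (x.1 \ b) b) hz' hzb'))⟩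

theorem mem_toCompletion (b : B) (x : Positive B) :
    x ∈ (toCompletion b : LowerSet (Positive B)) ↔ x.1 ≤ b := Iff.rfl

theorem toCompletion_le_iff {a b : B} : toCompletion a ≤ toCompletion b ↔ a ≤ b := by
  constructor
  · intro h
    by_cases ha : a = ⊥
    · simp [ha]
    · exact h (show (⟨a, ha⟩ : Positive B) ∈ (toCompletion a : LowerSet (Positive B)) from le_rfl)
  · intro h x hx
    exact le_trans hx h

theorem toCompletion_inf (a b : B) :
    toCompletion (a ⊓ b) = toCompletion a ⊓ toCompletion b := by
  apply Heyting.Regular.coe_injective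
  ext x
  exact le_inf_iff

theorem toCompletion_compl (a : B) : toCompletion aᶜ = (toCompletion a)ᶜ := by
  apply Heyting.Regular.coe_injective
  rw [Heyting.Regular.coe_compl]
  ext x
  change x ∈ (toCompletion aᶜ : LowerSet (Positive B)) ↔ x ∈ ((toCompletion a : LowerSet (Positive B))ᶜ : LowerSet (Positive B))
  rw [mem_heytingCompl, mem_toCompletion]
  constructor
  · intro h y hy hya
    exact y.2 (le_bot_iff.1 ((disjoint_compl_right : Disjoint a aᶜ) hya (le_trans hy h)))
  · intro h
    rw [le_compl_iff_disjoint_right, disjoint_iff]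
    by_contra hne
    exact h ⟨x.1 ⊓ a, hne⟩ inf_le_left inf_le_right

/-- A Boolean algebra is dense in its completion. -/
theorem exists_toCompletion_le (c : BoolCompletion B) (hc : c ≠ ⊥) :
    ∃ b : B, b ≠ ⊥ ∧ toCompletion b ≤ c := by
  by_contra h
  push Not at h
  apply hc
  apply Heyting.Regular.coe_injective
  ext x
  constructor
  · intro hx
    exact (h x.1 x.2 (fun y hy => c.1.lower hy hx)).elim
  · intro hx
    exact hx.elim

/-- The completion is a complete lattice. -/
theorem exists_isLUB (S : Set (BoolCompletion B)) : ∃ c, IsLUB S c := by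
  refine ⟨Heyting.Regular.toRegular (sSup (Heyting.Regular.val '' S)), ?_, ?_⟩
  · intro s hs
    have h : s.val ≤ sSup (Heyting.Regular.val '' S) := le_sSup ⟨s, hs, rfl⟩
    exact h.trans le_compl_compl
  · intro c hc
    refine Heyting.Regular.gi.gc.l_le (sSup_le ?_)
    rintro _ ⟨s, hs, rfl⟩
    exact hc hs

end Completion

section Generators

/-- `FI A M`: the partial functions from `A` to `M` with finite domain. -/
structure FI (A : Type u) (M : Type v) where
  dom : Finset A
  toFun : dom → M

variable {A : Type u} {M : Type v}

/-- The set of all total functions `A → M` extending `f`. -/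
def FI.cylinder (f : FI A M) : Set (A → M) := {η | ∀ a : f.dom, η a = f.toFun a}

/-- `𝔅⁰`: the Boolean algebra generated by independent partitions of `1`, indexed by `A`, each
with pieces indexed by `M`. Its generators are the elements `x_f`, `f ∈ FI A M`, with `x_f ≤ x_g` if
`f` extends `g`, and `x_f ⊓ x_g ≠ 0` iff `f` and `g` are compatible. It is realized as the algebra of
subsets of `A → M` generated by the cylinders; the pieces of the `a`-th partition are
`{η | η a = j}`, `j : M`. -/
abbrev CylAlg (A : Type u) (M : Type v) : Type (max u v) :=
  BooleanSubalgebra.closure (Set.range (FI.cylinder : FI A M → Set (A → M)))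

/-- The generator `x_f` of `𝔅⁰`. -/
def CylAlg.gen (f : FI A M) : CylAlg A M :=
  ⟨f.cylinder, BooleanSubalgebra.subset_closure ⟨f, rfl⟩⟩

/-- `f` and `g` are compatible: they agree on the intersection of their domains. -/
def FI.Compatible (f g : FI A M) : Prop :=
  ∀ (a : A) (hf : a ∈ f.dom) (hg : a ∈ g.dom), f.toFun ⟨a, hf⟩ = g.toFun ⟨a, hg⟩

theorem CylAlg.gen_le_gen (f g : FI A M)
    (h : ∀ (a : A) (hg : a ∈ g.dom), ∃ hf : a ∈ f.dom, f.toFun ⟨a, hf⟩ = g.toFun ⟨a, hg⟩) :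
    CylAlg.gen f ≤ CylAlg.gen g := by
  rintro η hη ⟨a, ha⟩
  obtain ⟨hf, e⟩ := h a ha
  rw [← e]
  exact hη ⟨a, hf⟩

theorem CylAlg.gen_inf_gen_ne_bot [Nonempty M] (f g : FI A M) :
    CylAlg.gen f ⊓ CylAlg.gen g ≠ ⊥ ↔ f.Compatible g := by
  classical
  constructor
  · intro h a hf hg
    have h' : (f.cylinder ∩ g.cylinder).Nonempty := by
      rw [Set.nonempty_iff_ne_empty]
      exact fun e => h (Subtype.ext e)
    obtain ⟨η, h1, h2⟩ := h'
    rw [← h1 ⟨a, hf⟩, ← h2 ⟨a, hg⟩]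
  · intro h e
    have e' : f.cylinder ∩ g.cylinder = ∅ := congrArg Subtype.val e
    let η : A → M := fun a => if hf : a ∈ f.dom then f.toFun ⟨a, hf⟩ else
      if hg : a ∈ g.dom then g.toFun ⟨a, hg⟩ else Classical.arbitrary M
    have : η ∈ f.cylinder ∩ g.cylinder := by
      refine ⟨fun a => by simp [η], fun a => ?_⟩
      by_cases hf : a.1 ∈ f.dom
      · simp only [η, hf, dif_pos]
        exact h a.1 hf a.2
      · simp [η, hf]
    rw [e'] at this
    exact this

/-- The generators are dense in `𝔅⁰`. -/
theorem CylAlg.exists_gen_le (b : CylAlg A M) (hb : b ≠ ⊥) : ∃ f, CylAlg.gen f ≤ b := by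
  classical
  have key : ∀ s ∈ BooleanSubalgebra.closure (Set.range (FI.cylinder : FI A M → Set (A → M))),
      ∃ d : Finset A, ∀ η θ : A → M, (∀ a ∈ d, η a = θ a) → (η ∈ s ↔ θ ∈ s) := by
    intro s hs
    induction hs using BooleanSubalgebra.closure_bot_sup_induction with
    | mem s hs =>
      obtain ⟨f, rfl⟩ := hs
      refine ⟨f.dom, fun η θ h => ?_⟩
      exact forall_congr' fun a => by rw [h a.1 a.2]
    | bot => exact ⟨∅, fun _ _ _ => Iff.rfl⟩
    | sup s hs t ht ihs iht =>
      obtain ⟨d, hd⟩ := ihs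
      obtain ⟨e, he⟩ := iht
      refine ⟨d ∪ e, fun η θ h => ?_⟩
      exact or_congr (hd η θ fun a ha => h a (Finset.mem_union_left _ ha))
        (he η θ fun a ha => h a (Finset.mem_union_right _ ha))
    | compl s hs ih =>
      obtain ⟨d, hd⟩ := ih
      exact ⟨d, fun η θ h => not_congr (hd η θ h)⟩
  have hne : (b.1).Nonempty := by
    rw [Set.nonempty_iff_ne_empty]
    exact fun e => hb (Subtype.ext e)
  obtain ⟨η, hη⟩ := hne
  obtain ⟨d, hd⟩ := key b.1 b.2
  exact ⟨⟨d, fun a => η a⟩, fun θ hθ => (hd θ η fun a ha => hθ ⟨a, ha⟩).2 hη⟩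

end Generators

/-- `𝔅¹_{α,μ}`: the completion of `𝔅⁰_{α,μ}`, whose generators are indexed by the finite partial
functions from the ordinal `α` to the cardinal `μ`. -/
abbrev B1 (α : Ordinal.{u}) (μ : Cardinal.{u}) : Type u :=
  BoolCompletion (CylAlg α.ToType μ.ord.ToType)

/-- A filter on a Boolean algebra is an ultrafilter if it is proper and contains each element or its
complement. -/
def IsUltra {B : Type u} [BooleanAlgebra B] (D : Order.PFilter B) : Prop :=
  ⊥ ∉ D ∧ ∀ b : B, b ∈ D ∨ bᶜ ∈ D

/-! ### Set mappings -/

/-- The relation `(lam, m, mu) ⟶ n`: for every set mapping `F : [lam]^m → [lam]^{<mu}`, i.e. with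
`F x ∩ x = ∅` for all `x`, there is a set `X ⊆ lam` with `n` elements that is free for `F`, i.e.
`F x ∩ X = ∅` for all `x ∈ [X]^m`. (The values of `F` on sets that do not have `m` elements play no
role.) -/
def SetMappingArrow (lam : Cardinal.{u}) (m : ℕ) (mu : Cardinal.{u}) (n : ℕ) : Prop :=
  ∀ F : Finset lam.ord.ToType → Set lam.ord.ToType,
    (∀ x : Finset lam.ord.ToType, x.card = m → #(F x) < mu ∧ Disjoint (F x) ↑x) →
    ∃ X : Finset lam.ord.ToType, X.card = n ∧
      ∀ x : Finset lam.ord.ToType, x ⊆ X → x.card = m → Disjoint (F x) ↑X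

/-! ### The theory of hypergraphs -/

/-- The relation symbols of the language of hypergraphs: one symbol, of arity `k+1`. -/
inductive HypRel (k : ℕ) : ℕ → Type
  | edge : HypRel k (k + 1)

/-- The language with one `(k+1)`-ary relation symbol. -/
def hypLang (k : ℕ) : FirstOrder.Language.{0, 0} := ⟨fun _ => Empty, HypRel k⟩

/-- The symbol `R`. -/
def edgeSym (k : ℕ) : (hypLang k).Relations (k + 1) := HypRel.edge

/-- The formula `R(x_{g 0}, …, x_{g k})`. -/
def edgeFormula {k : ℕ} {β : Type*} (g : Fin (k + 1) → β) : (hypLang k).Formula β :=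
  (edgeSym k).formula fun i => Term.var (g i)

/-- The formula `x_i = x_j`. -/
def eqFormula {k : ℕ} {β : Type*} (i j : β) : (hypLang k).Formula β :=
  Term.equal (Term.var i) (Term.var j)

/-- The universal closure of a formula. -/
noncomputable def univClosure {L : FirstOrder.Language.{0, 0}} {n : ℕ} (φ : L.Formula (Fin n)) : L.Sentence :=
  Formula.iAlls (Fin n) (φ.relabel (Sum.inr : Fin n → Empty ⊕ Fin n))

section
variable {k : ℕ} {N : Type*} [(hypLang k).Structure N]

/-- `R` holds in the structure. -/
def Edge (k : ℕ) {N : Type*} [(hypLang k).Structure N] (t : Fin (k + 1) → N) : Prop :=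
  Structure.RelMap (edgeSym k) t

theorem realize_edgeFormula {β : Type*} (g : Fin (k + 1) → β) (v : β → N) :
    (edgeFormula g).Realize v ↔ Edge k (v ∘ g) := by
  simp only [edgeFormula, Formula.realize_rel, Edge]
  rfl

theorem realize_eqFormula {β : Type*} (i j : β) (v : β → N) :
    (eqFormula (k := k) i j).Realize v ↔ v i = v j := by
  simp [eqFormula]
end

theorem realize_univClosure {L : FirstOrder.Language.{0, 0}} {N : Type*} [L.Structure N] {n : ℕ}
    (φ : L.Formula (Fin n)) : N ⊨ univClosure φ ↔ ∀ a : Fin n → N, φ.Realize a := by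
  simp only [univClosure, Sentence.Realize, Formula.realize_iAlls, Formula.realize_relabel]
  exact Iff.rfl

/-- The theory of one symmetric irreflexive `(k+1)`-ary relation `R` with no complete graph on `m+1`
vertices. Irreflexive means that `R` holds only of tuples of distinct elements; a complete graph on
`m+1` vertices consists of distinct elements `x_0, …, x_m` such that `R` holds of all `(k+1)`-tuples
of distinct ones among them. -/
def hypTheory (m k : ℕ) : (hypLang k).Theory :=
  {φ | ∃ σ : Equiv.Perm (Fin (k + 1)),
      φ = univClosure ((edgeFormula id).imp (edgeFormula σ))} ∪
  {φ | ∃ i j : Fin (k + 1), i ≠ j ∧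
      φ = univClosure ((edgeFormula id).imp (eqFormula i j).not)} ∪
  {univClosure (Formula.not
    ((Formula.iInf fun p : {p : Fin (m + 1) × Fin (m + 1) // p.1 ≠ p.2} =>
        (eqFormula p.1.1 p.1.2).not) ⊓
      Formula.iInf fun g : Fin (k + 1) ↪ Fin (m + 1) => edgeFormula g))}

/-- The semantic content of `hypTheory`. -/
structure IsHyp (m k : ℕ) (N : Type*) [(hypLang k).Structure N] : Prop where
  symm : ∀ (σ : Equiv.Perm (Fin (k + 1))) (t : Fin (k + 1) → N), Edge k t → Edge k (t ∘ σ)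
  irrefl : ∀ t : Fin (k + 1) → N, Edge k t → Function.Injective t
  free : ∀ z : Fin (m + 1) → N, Function.Injective z →
    ¬ ∀ g : Fin (k + 1) ↪ Fin (m + 1), Edge k (z ∘ g)

theorem models_hypTheory_iff {m k : ℕ} {N : Type*} [(hypLang k).Structure N] :
    N ⊨ hypTheory m k ↔ IsHyp m k N := by
  constructor
  · intro h
    have h' := fun φ hφ => Theory.realize_sentence_of_mem (M := N) (hypTheory m k) (φ := φ) hφ
    refine ⟨fun σ t ht => ?_, fun t ht i j hij => ?_, fun z hz hg => ?_⟩
    · have := h' _ (Or.inl (Or.inl ⟨σ, rfl⟩))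
      rw [realize_univClosure] at this
      have := this t
      rw [Formula.realize_imp, realize_edgeFormula, realize_edgeFormula] at this
      exact this ht
    · by_contra hne
      have := h' _ (Or.inl (Or.inr ⟨i, j, hne, rfl⟩))
      rw [realize_univClosure] at this
      have := this t
      rw [Formula.realize_imp, realize_edgeFormula, Formula.realize_not, realize_eqFormula] at this
      exact this ht hij
    · have := h' _ (Or.inr rfl)
      rw [realize_univClosure] at this
      have := this z
      simp only [Formula.realize_not, Formula.realize_inf, Formula.realize_iInf,
        realize_edgeFormula, realize_eqFormula] at this
      exact this ⟨fun p hp => p.2 (hz hp), hg⟩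
  · intro h
    refine ⟨fun φ hφ => ?_⟩
    rcases hφ with (⟨σ, rfl⟩ | ⟨i, j, hij, rfl⟩) | rfl
    · rw [realize_univClosure]
      intro t
      rw [Formula.realize_imp, realize_edgeFormula, realize_edgeFormula]
      exact h.symm σ t
    · rw [realize_univClosure]
      intro t
      rw [Formula.realize_imp, realize_edgeFormula, Formula.realize_not, realize_eqFormula]
      exact fun ht e => hij (h.irrefl t ht e)
    · rw [realize_univClosure]
      intro z
      simp only [Formula.realize_not, Formula.realize_inf, Formula.realize_iInf,
        realize_edgeFormula, realize_eqFormula]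
      rintro ⟨h1, h2⟩
      refine h.free z (fun i j hij => ?_) h2
      by_contra hne
      exact h1 ⟨(i, j), hne⟩ hij

/-- `T'` is a model completion of `T`: every model of `T'` is a model of `T`, every model of `T`
embeds into a model of `T'`, and for every model `M` of `T`, the theory `T'` together with the
atomic diagram of `M` is complete, i.e. any two models of `T'` extending `M` satisfy the same
formulas with parameters in `M`. A model completion is unique up to logical equivalence. -/
structure IsModelCompletion {L : FirstOrder.Language.{0, 0}} (T T' : L.Theory) : Prop where
  models : ∀ N : T'.ModelType.{0, 0, 0}, N ⊨ T
  extend : ∀ M : T.ModelType.{0, 0, 0}, ∃ N : T'.ModelType.{0, 0, 0}, Nonempty (M ↪[L] N)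
  complete : ∀ (M : T.ModelType.{0, 0, 0}) (N₁ N₂ : T'.ModelType.{0, 0, 0}) (f₁ : M ↪[L] N₁) (f₂ : M ↪[L] N₂)
    (n : ℕ) (φ : L.Formula (Fin n)) (a : Fin n → M),
    φ.Realize (f₁ ∘ a) ↔ φ.Realize (f₂ ∘ a)

/-! ### Existence of the model completion of `hypTheory m k` -/

section QF
variable {k : ℕ} {β γ : Type*} {N N' : Type*} [(hypLang k).Structure N] [(hypLang k).Structure N']

/-- Two families satisfy the same atomic formulas. -/
def SameQF (k : ℕ) {β N N' : Type*} [(hypLang k).Structure N] [(hypLang k).Structure N'] (p : β → N) (q : β → N') : Prop :=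
  (∀ i j, p i = p j ↔ q i = q j) ∧ ∀ g : Fin (k + 1) → β, Edge k (p ∘ g) ↔ Edge k (q ∘ g)

theorem SameQF.comp {p : β → N} {q : β → N'} (h : SameQF k p q) (e : γ → β) :
    SameQF k (p ∘ e) (q ∘ e) :=
  ⟨fun i j => h.1 (e i) (e j), fun g => h.2 (e ∘ g)⟩

open Classical in
/-- The conjunction of the atomic and negated atomic formulas satisfied by a finite family. -/
noncomputable def diagFormula [Finite β] (q : β → N) : (hypLang k).Formula β :=
  (Formula.iInf fun p : β × β =>
    if q p.1 = q p.2 then eqFormula p.1 p.2 else (eqFormula p.1 p.2).not) ⊓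
  Formula.iInf fun g : Fin (k + 1) → β =>
    if Edge k (q ∘ g) then edgeFormula g else (edgeFormula g).not

theorem realize_diagFormula [Finite β] (q : β → N) (p : β → N') :
    (diagFormula (k := k) q).Realize p ↔ SameQF k p q := by
  simp only [diagFormula, Formula.realize_inf, Formula.realize_iInf, SameQF, Prod.forall]
  refine and_congr (forall_congr' fun i => forall_congr' fun j => ?_) (forall_congr' fun g => ?_)
  · split_ifs with h <;> simp [Formula.realize_not, realize_eqFormula, h]
  · split_ifs with h <;> simp [Formula.realize_not, realize_edgeFormula, h]

/-- The extension axiom: a family that satisfies the same atomic formulas as `q` can be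
extended by an element in the same way as `q` is extended by `y`. -/
noncomputable def extAxiom {n : ℕ} (q : Fin n → N) (y : N) : (hypLang k).Sentence :=
  univClosure ((diagFormula q).imp
    (Formula.iExs Unit (diagFormula (Sum.elim q fun _ : Unit => y))))

theorem realize_extAxiom {n : ℕ} (q : Fin n → N) (y : N) :
    N' ⊨ extAxiom (k := k) q y ↔ ∀ p : Fin n → N', SameQF k p q →
      ∃ x : N', SameQF k (Sum.elim p fun _ : Unit => x) (Sum.elim q fun _ : Unit => y) := by
  rw [extAxiom, realize_univClosure]
  refine forall_congr' fun p => ?_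
  rw [Formula.realize_imp, realize_diagFormula, Formula.realize_iExs]
  refine imp_congr Iff.rfl ⟨?_, ?_⟩
  · rintro ⟨i, hi⟩
    exact ⟨i (), (realize_diagFormula _ _).1 hi⟩
  · rintro ⟨x, hx⟩
    exact ⟨fun _ => x, (realize_diagFormula _ _).2 hx⟩

end QF

/-- The theory of the generic hypergraph: `hypTheory` with all extension axioms. -/
def genericTheory (m k : ℕ) : (hypLang k).Theory :=
  hypTheory m k ∪ {φ | ∃ (H : (hypTheory m k).ModelType.{0, 0, 0}) (n : ℕ) (q : Fin n → H) (y : H),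
    φ = extAxiom q y}

section QE
variable {m k : ℕ}

theorem exists_ext {N : Type*} [(hypLang k).Structure N] (hN : N ⊨ genericTheory m k)
    (H : (hypTheory m k).ModelType.{0, 0, 0}) {β : Type*} [Finite β] (q : β → H) (p : β → N)
    (h : SameQF k p q) (y : H) :
    ∃ x : N, SameQF k (Sum.elim p fun _ : Unit => x) (Sum.elim q fun _ : Unit => y) := by
  obtain ⟨n, ⟨e⟩⟩ := Finite.exists_equiv_fin β
  have h1 : N ⊨ extAxiom (q ∘ e.symm) y :=
    Theory.realize_sentence_of_mem (genericTheory m k) (Or.inr ⟨H, n, q ∘ e.symm, y, rfl⟩)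
  obtain ⟨x, hx⟩ := (realize_extAxiom _ _).1 h1 (p ∘ e.symm) (h.comp e.symm)
  refine ⟨x, ?_⟩
  have := hx.comp (Sum.map e (id : Unit → Unit))
  simpa [Function.comp_def, Sum.elim_map] using this

theorem SameQF.symm' {β N N' : Type*} [(hypLang k).Structure N] [(hypLang k).Structure N']
    {p : β → N} {q : β → N'} (h : SameQF k p q) : SameQF k q p :=
  ⟨fun i j => (h.1 i j).symm, fun g => (h.2 g).symm⟩

theorem SameQF.snoc {n l : ℕ} {N N' : Type w} [(hypLang k).Structure N] [(hypLang k).Structure N']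
    {v : Fin n → N} {xs : Fin l → N} {v' : Fin n → N'} {xs' : Fin l → N'} {x : N} {x' : N'}
    (h : SameQF k (Sum.elim (Sum.elim v xs) fun _ : Unit => x)
      (Sum.elim (Sum.elim v' xs') fun _ : Unit => x')) :
    SameQF k (Sum.elim v (Fin.snoc xs x : Fin (l + 1) → N))
      (Sum.elim v' (Fin.snoc xs' x' : Fin (l + 1) → N')) := by
  let e : Fin n ⊕ Fin (l + 1) → (Fin n ⊕ Fin l) ⊕ Unit :=
    Sum.elim (fun i => Sum.inl (Sum.inl i))
      (Fin.snoc (α := fun _ => (Fin n ⊕ Fin l) ⊕ Unit) (fun i => Sum.inl (Sum.inr i)) (Sum.inr ()))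
  have he : ∀ {P : Type w} (v : Fin n → P) (xs : Fin l → P) (x : P),
      (Sum.elim (Sum.elim v xs) fun _ : Unit => x) ∘ e = Sum.elim v (Fin.snoc xs x : Fin (l + 1) → P) := by
    intro P v xs x
    funext i
    rcases i with i | i
    · rfl
    · refine Fin.lastCases ?_ (fun i => ?_) i <;> simp [e]
  have := h.comp e
  rwa [he, he] at this

theorem realize_iff_of_sameQF (N N' : (genericTheory m k).ModelType.{0, 0, 0}) {n l : ℕ}
    (φ : (hypLang k).BoundedFormula (Fin n) l) (v : Fin n → N) (xs : Fin l → N)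
    (v' : Fin n → N') (xs' : Fin l → N') (h : SameQF k (Sum.elim v xs) (Sum.elim v' xs')) :
    φ.Realize v xs ↔ φ.Realize v' xs' := by
  have term : ∀ {l : ℕ} (t : (hypLang k).Term (Fin n ⊕ Fin l)), ∃ i, t = Term.var i := by
    intro l t
    cases t with
    | var i => exact ⟨i, rfl⟩
    | func f _ => exact f.elim
  induction φ with
  | falsum => exact Iff.rfl
  | equal t₁ t₂ =>
    obtain ⟨i, rfl⟩ := term t₁
    obtain ⟨j, rfl⟩ := term t₂
    exact h.1 i j
  | rel R ts =>
    cases R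
    choose g hg using fun i => term (ts i)
    obtain rfl : ts = fun i => Term.var (g i) := funext hg
    exact h.2 g
  | imp φ ψ ih₁ ih₂ => exact imp_congr (ih₁ _ _ h) (ih₂ _ _ h)
  | all φ ih =>
    simp only [BoundedFormula.realize_all]
    constructor
    · intro H y
      obtain ⟨x, hx⟩ := exists_ext N.is_model (N'.subtheoryModel Set.subset_union_left) _ _ h y
      exact (ih _ _ hx.snoc).1 (H x)
    · intro H y
      obtain ⟨x, hx⟩ := exists_ext N'.is_model (N.subtheoryModel Set.subset_union_left) _ _ h.symm' y
      exact (ih _ _ hx.symm'.snoc).2 (H x)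

end QE

section Extend
variable {m k : ℕ}

/-- A one-point extension problem over `N`: a finite family `p` in `N`, and the set `S` of the edges
to be formed by `p` and a new point, as they occur in some model of `hypTheory m k`. -/
structure Problem (m k : ℕ) (N : Type) [(hypLang k).Structure N] : Type where
  n : ℕ
  p : Fin n → N
  S : (Fin (k + 1) → Fin n ⊕ Unit) → Prop
  spec : ∃ (H : (hypTheory m k).ModelType.{0, 0, 0}) (q : Fin n → H) (y : H), SameQF k p q ∧
    (∀ i, q i ≠ y) ∧ ∀ g, S g ↔ Edge k ((Sum.elim q fun _ : Unit => y) ∘ g)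

variable {N : Type} [(hypLang k).Structure N]

/-- The family of a problem with its new point. -/
def Problem.point (c : Problem m k N) : Fin c.n ⊕ Unit → N ⊕ Problem m k N :=
  Sum.elim (fun i => Sum.inl (c.p i)) fun _ => Sum.inr c

/-- The hypergraph on `N` and one new point for each problem over `N`. -/
instance extStructure : (hypLang k).Structure (N ⊕ Problem m k N) where
  funMap f _ := f.elim
  RelMap {n} R := match n, R with
    | _, HypRel.edge => fun t => (∃ t₀ : Fin (k + 1) → N, t = Sum.inl ∘ t₀ ∧ Edge k t₀) ∨
      ∃ (c : Problem m k N) (g : Fin (k + 1) → Fin c.n ⊕ Unit), t = c.point ∘ g ∧ c.S g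

theorem edge_ext_iff (t : Fin (k + 1) → N ⊕ Problem m k N) :
    Edge k t ↔ (∃ t₀ : Fin (k + 1) → N, t = Sum.inl ∘ t₀ ∧ Edge k t₀) ∨
      ∃ (c : Problem m k N) (g : Fin (k + 1) → Fin c.n ⊕ Unit), t = c.point ∘ g ∧ c.S g := Iff.rfl

theorem Problem.point_eq (c : Problem m k N) {H : (hypTheory m k).ModelType.{0, 0, 0}} {q : Fin c.n → H}
    {y : H} (h : SameQF k c.p q) (hy : ∀ i, q i ≠ y) (i j : Fin c.n ⊕ Unit) :
    c.point i = c.point j ↔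
      (Sum.elim q fun _ : Unit => y) i = (Sum.elim q fun _ : Unit => y) j := by
  rcases i with i | i <;> rcases j with j | j
  · simpa [Problem.point] using h.1 i j
  · simpa [Problem.point] using hy i
  · simpa [Problem.point] using (hy j).symm
  · simp [Problem.point]

/-- If all values are old, then the tuple is old. -/
theorem Problem.old (c : Problem m k N) (g : Fin (k + 1) → Fin c.n ⊕ Unit)
    (t₀ : Fin (k + 1) → N) (h : Sum.inl ∘ t₀ = c.point ∘ g) : c.S g ↔ Edge k t₀ := by
  obtain ⟨H, q, y, hq, hy, hS⟩ := c.spec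
  have : ∀ i, ∃ j, g i = Sum.inl j ∧ t₀ i = c.p j := by
    intro i
    have hi := congrFun h i
    simp only [Function.comp] at hi
    rcases hg : g i with j | j
    · rw [hg] at hi
      exact ⟨j, rfl, Sum.inl_injective hi⟩
    · rw [hg] at hi
      exact (Sum.inl_ne_inr hi).elim
  choose j hj hj' using this
  obtain rfl : g = fun i => Sum.inl (j i) := funext hj
  obtain rfl : t₀ = fun i => c.p (j i) := funext hj'
  rw [hS]
  exact (hq.2 j).symm

theorem edge_inl (t₀ : Fin (k + 1) → N) :
    Edge k (Sum.inl ∘ t₀ : Fin (k + 1) → N ⊕ Problem m k N) ↔ Edge k t₀ := by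
  rw [edge_ext_iff]
  constructor
  · rintro (⟨t₁, h, ht⟩ | ⟨c, g, h, hg⟩)
    · obtain rfl : t₀ = t₁ := funext fun i => Sum.inl_injective (congrFun h i)
      exact ht
    · exact (c.old g t₀ h).1 hg
  · exact fun h => Or.inl ⟨t₀, rfl, h⟩

theorem Problem.edge_point (c : Problem m k N) (g : Fin (k + 1) → Fin c.n ⊕ Unit) :
    Edge k (c.point ∘ g) ↔ c.S g := by
  constructor
  · rw [edge_ext_iff]
    rintro (⟨t₁, h, ht⟩ | ⟨c', g', h, hg⟩)
    · exact (c.old g t₁ h.symm).2 ht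
    · by_cases hold : ∃ t₀ : Fin (k + 1) → N, Sum.inl ∘ t₀ = c.point ∘ g
      · obtain ⟨t₀, ht₀⟩ := hold
        exact (c.old g t₀ ht₀).2 ((c'.old g' t₀ (ht₀.trans h)).1 hg)
      · have : ∃ i, ∀ x, c.point (g i) ≠ Sum.inl x := by
          by_contra hno
          push Not at hno
          choose t₀ ht₀ using hno
          exact hold ⟨t₀, funext fun i => (ht₀ i).symm⟩
        obtain ⟨i, hi⟩ := this
        have hc : c.point (g i) = Sum.inr c := by
          rcases hgi : g i with j | j
          · exact (hi (c.p j) (by rw [hgi]; rfl)).elim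
          · rfl
        have hc' : c'.point (g' i) = Sum.inr c := hc ▸ (congrFun h i).symm
        have hcc : c' = c := by
          rcases hgi : g' i with j | j
          · rw [hgi] at hc'
            exact (Sum.inl_ne_inr hc').elim
          · rw [hgi] at hc'
            exact Sum.inr_injective hc'
        subst hcc
        obtain ⟨H, q, y, hq, hy, hS⟩ := c'.spec
        rw [hS] at hg ⊢
        have : (Sum.elim q fun _ : Unit => y) ∘ g = (Sum.elim q fun _ : Unit => y) ∘ g' :=
          funext fun i => (c'.point_eq hq hy _ _).1 (congrFun h i)
        rwa [this]
  · exact fun h => Or.inr ⟨c, g, rfl, h⟩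

theorem isHyp_ext (hk : 1 ≤ k) (hkm : k ≤ m) (hN : IsHyp m k N) :
    IsHyp m k (N ⊕ Problem m k N) := by
  refine ⟨fun σ t ht => ?_, fun t ht => ?_, fun z hz hcl => ?_⟩
  · rcases (edge_ext_iff t).1 ht with ⟨t₀, rfl, h₀⟩ | ⟨c, g, rfl, hg⟩
    · exact (edge_inl (t₀ ∘ σ)).2 (hN.symm σ t₀ h₀)
    · refine (c.edge_point (g ∘ σ)).2 ?_
      obtain ⟨H, q, y, hq, hy, hS⟩ := c.spec
      rw [hS] at hg ⊢
      exact (models_hypTheory_iff.1 H.is_model).symm σ _ hg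
  · rcases (edge_ext_iff t).1 ht with ⟨t₀, rfl, h₀⟩ | ⟨c, g, rfl, hg⟩
    · exact Sum.inl_injective.comp (hN.irrefl t₀ h₀)
    · obtain ⟨H, q, y, hq, hy, hS⟩ := c.spec
      rw [hS] at hg
      intro i j hij
      exact (models_hypTheory_iff.1 H.is_model).irrefl _ hg ((c.point_eq hq hy _ _).1 hij)
  · by_cases hold : ∃ z₀ : Fin (m + 1) → N, Sum.inl ∘ z₀ = z
    · obtain ⟨z₀, rfl⟩ := hold
      exact hN.free z₀ (fun i j h => hz (congrArg Sum.inl h)) fun g => (edge_inl (z₀ ∘ g)).1 (hcl g)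
    · have : ∃ i, ∀ x, z i ≠ Sum.inl x := by
        by_contra hno
        push Not at hno
        choose z₀ hz₀ using hno
        exact hold ⟨z₀, funext fun i => (hz₀ i).symm⟩
      obtain ⟨i, hi⟩ := this
      obtain ⟨c, hc⟩ : ∃ c, z i = Sum.inr c := by
        rcases hzi : z i with x | c
        · exact (hi x hzi).elim
        · exact ⟨c, rfl⟩
      have hrange : ∀ j, ∃ b, z j = c.point b := by
        intro j
        obtain ⟨g, ⟨a, ha⟩, ⟨b, hb⟩⟩ :
            ∃ g : Fin (k + 1) ↪ Fin (m + 1), (∃ a, g a = i) ∧ ∃ b, g b = j := by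
          obtain ⟨s, hs, hcard⟩ := Finset.exists_superset_card_eq
            (s := ({i, j} : Finset (Fin (m + 1)))) (n := k + 1)
            (Finset.card_le_two.trans (by omega)) (by simpa using hkm)
          have e := s.equivFinOfCardEq hcard
          refine ⟨e.symm.toEmbedding.trans (Function.Embedding.subtype _),
            ⟨e ⟨i, hs (by simp)⟩, by simp⟩, ⟨e ⟨j, hs (by simp)⟩, by simp⟩⟩
        rcases (edge_ext_iff _).1 (hcl g) with ⟨t₀, h, -⟩ | ⟨c', g', h, -⟩
        · have := congrFun h a
          simp only [Function.comp, ha] at this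
          exact (hi _ this).elim
        · have h1 := congrFun h a
          have h2 := congrFun h b
          simp only [Function.comp, ha, hb] at h1 h2
          have : c = c' := by
            rw [hc] at h1
            rcases hga : g' a with l | l
            · rw [hga] at h1
              exact (Sum.inl_ne_inr h1.symm).elim
            · rw [hga] at h1
              exact Sum.inr_injective h1
          subst this
          exact ⟨_, h2⟩
      choose b hb using hrange
      obtain rfl : z = c.point ∘ b := funext hb
      obtain ⟨H, q, y, hq, hy, hS⟩ := c.spec
      refine (models_hypTheory_iff.1 H.is_model).free ((Sum.elim q fun _ : Unit => y) ∘ b)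
        (fun i j hij => hz ((c.point_eq hq hy _ _).2 hij)) fun g => ?_
      exact (hS _).1 ((c.edge_point (b ∘ g)).1 (hcl g))

/-- The extension of a model by solutions of all extension problems over it. -/
def step (hk : 1 ≤ k) (hkm : k ≤ m) (M : (hypTheory m k).ModelType.{0, 0, 0}) :
    (hypTheory m k).ModelType.{0, 0, 0} :=
  haveI : (M ⊕ Problem m k M) ⊨ hypTheory m k :=
    models_hypTheory_iff.2 (isHyp_ext hk hkm (models_hypTheory_iff.1 M.is_model))
  Theory.ModelType.of _ (M ⊕ Problem m k M)

/-- The inclusion of a model into its extension. -/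
def stepEmb (hk : 1 ≤ k) (hkm : k ≤ m) (M : (hypTheory m k).ModelType.{0, 0, 0}) :
    M ↪[hypLang k] step hk hkm M where
  toFun := (Sum.inl : M → M ⊕ Problem m k M)
  inj' := Sum.inl_injective
  map_fun' f _ := f.elim
  map_rel' r x := by
    cases r
    exact edge_inl x

/-- The iterated extensions of a model. -/
def chain (hk : 1 ≤ k) (hkm : k ≤ m) (M : (hypTheory m k).ModelType.{0, 0, 0}) :
    ℕ → (hypTheory m k).ModelType.{0, 0, 0}
  | 0 => M
  | n + 1 => step hk hkm (chain hk hkm M n)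

/-- The inclusions between the iterated extensions. -/
def chainEmb (hk : 1 ≤ k) (hkm : k ≤ m) (M : (hypTheory m k).ModelType.{0, 0, 0}) (n : ℕ) :
    chain hk hkm M n ↪[hypLang k] chain hk hkm M (n + 1) :=
  stepEmb hk hkm (chain hk hkm M n)

/-- Every model of `hypTheory` embeds into a model of `genericTheory`. -/
theorem exists_generic_extension (hk : 1 ≤ k) (hkm : k ≤ m)
    (M : (hypTheory m k).ModelType.{0, 0, 0}) :
    ∃ N : (genericTheory m k).ModelType.{0, 0, 0}, Nonempty (M ↪[hypLang k] N) := by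
  let G : ℕ → Type := fun n => chain hk hkm M n
  let f := DirectedSystem.natLERec (L := hypLang k) (G' := G) (chainEmb hk hkm M)
  let D := FirstOrder.Language.DirectLimit G f
  let o : ∀ i, G i ↪[hypLang k] D := fun i => FirstOrder.Language.DirectLimit.of (hypLang k) ℕ G f i
  have lift : ∀ {β : Type} [Finite β] (x : β → D), ∃ i, ∃ x' : β → G i, x = o i ∘ x' := by
    intro β _ x
    obtain ⟨i, x', hx⟩ := FirstOrder.Language.DirectLimit.exists_quotient_mk'_sigma_mk'_eq G f x
    exact ⟨i, x', hx⟩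
  have edge : ∀ i (t : Fin (k + 1) → G i), Edge k (o i ∘ t) ↔ Edge k t :=
    fun i t => (o i).map_rel (edgeSym k) t
  have hD : IsHyp m k D := by
    refine ⟨fun σ t ht => ?_, fun t ht => ?_, fun z hz hcl => ?_⟩
    · obtain ⟨i, t, rfl⟩ := lift t
      exact (edge i (t ∘ σ)).2
        ((models_hypTheory_iff.1 (chain hk hkm M i).is_model).symm σ t ((edge i t).1 ht))
    · obtain ⟨i, t, rfl⟩ := lift t
      exact (o i).injective.comp
        ((models_hypTheory_iff.1 (chain hk hkm M i).is_model).irrefl t ((edge i t).1 ht))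
    · obtain ⟨i, z, rfl⟩ := lift z
      exact (models_hypTheory_iff.1 (chain hk hkm M i).is_model).free z
        (fun a b h => hz (congrArg (o i) h)) fun g => (edge i (z ∘ g)).1 (hcl g)
  have hD1 : D ⊨ genericTheory m k := by
    refine ⟨fun φ hφ => ?_⟩
    rcases hφ with hφ | ⟨H, n, q, y, rfl⟩
    · exact (models_hypTheory_iff.2 hD).realize_of_mem φ hφ
    · rw [realize_extAxiom]
      intro p hpq
      by_cases hy : ∃ j, q j = y
      · obtain ⟨j, rfl⟩ := hy
        refine ⟨p j, ?_⟩
        have := hpq.comp (Sum.elim id fun _ : Unit => j)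
        rwa [Sum.comp_elim, Sum.comp_elim] at this
      · push Not at hy
        obtain ⟨i, p, rfl⟩ := lift p
        have hp : SameQF k p q := by
          refine ⟨fun a b => ?_, fun g => ?_⟩
          · rw [← hpq.1 a b]
            exact (o i).injective.eq_iff.symm
          · rw [← hpq.2 g]
            exact (edge i (p ∘ g)).symm
        let c : Problem m k (chain hk hkm M i) :=
          ⟨n, p, fun g => Edge k ((Sum.elim q fun _ : Unit => y) ∘ g), H, q, y, hp, hy,
            fun _ => Iff.rfl⟩
        let x : Fin n ⊕ Unit → G (i + 1) := c.point
        refine ⟨o (i + 1) (x (Sum.inr ())), ?_⟩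
        have hx : (Sum.elim (o i ∘ p) fun _ : Unit => o (i + 1) (x (Sum.inr ()))) =
            o (i + 1) ∘ x := by
          funext a
          rcases a with a | a
          · change o i (p a) = o (i + 1) (chainEmb hk hkm M i (p a))
            have h := FirstOrder.Language.DirectLimit.of_f (L := hypLang k) (G := G) (f := f)
              (hij := Nat.le_succ i) (x := p a)
            have h2 : f i (i + 1) (Nat.le_succ i) (p a) = chainEmb hk hkm M i (p a) := by
              change (DirectedSystem.natLERec (L := hypLang k) (G' := G) (chainEmb hk hkm M)
                i (i + 1) (Nat.le_succ i)) (p a) = _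
              rw [DirectedSystem.coe_natLERec]
              exact Nat.leRecOn_succ' (C := G) (next := fun {n} => chainEmb hk hkm M n) (p a)
            exact h.symm.trans (congrArg (o (i + 1)) h2)
          · rfl
        rw [hx]
        refine ⟨fun a b => ?_, fun g => ?_⟩
        · exact (o (i + 1)).injective.eq_iff.trans (c.point_eq hp hy a b)
        · exact (edge (i + 1) (x ∘ g)).trans (c.edge_point g)
  have : Nonempty D := ⟨o 0 (Classical.arbitrary M)⟩
  exact ⟨Theory.ModelType.of _ D, ⟨o 0⟩⟩

/-- The model completion of `hypTheory m k` exists for `m ≥ k ≥ 1`. -/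
theorem isModelCompletion_genericTheory (hk : 1 ≤ k) (hkm : k ≤ m) :
    IsModelCompletion (hypTheory m k) (genericTheory m k) where
  models N := (N.subtheoryModel Set.subset_union_left).is_model
  extend := exists_generic_extension hk hkm
  complete M N₁ N₂ f₁ f₂ n φ a := by
    refine realize_iff_of_sameQF N₁ N₂ φ _ _ _ _ ⟨?_, ?_⟩
    · rintro (i | i) (j | j)
      · exact (f₁.injective.eq_iff).trans (f₂.injective.eq_iff).symm
      · exact j.elim0
      · exact i.elim0
      · exact i.elim0
    · intro g
      have hg : ∃ g' : Fin (k + 1) → Fin n, g = fun i => Sum.inl (g' i) := by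
        choose g' hg' using fun i => show ∃ j, g i = Sum.inl j by
          rcases g i with j | j
          · exact ⟨j, rfl⟩
          · exact j.elim0
        exact ⟨g', funext hg'⟩
      obtain ⟨g', rfl⟩ := hg
      exact (f₁.map_rel (edgeSym k) (a ∘ g')).trans (f₂.map_rel (edgeSym k) (a ∘ g')).symm

end Extend

/-! ### Possibility patterns and moral ultrafilters -/

section Moral

variable {L : FirstOrder.Language.{0, 0}} {B : Type u} [BooleanAlgebra B]

/-- The formulas `φ(x; y_0, …, y_{n-1})`, with one distinguished variable `x` and a finite tuple of
parameter variables. -/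
abbrev ParamFormula (L : FirstOrder.Language.{0, 0}) : Type := Σ n : ℕ, L.Formula (Unit ⊕ Fin n)

/-- `M ⊨ φ(x; a)`. -/
def ParamFormula.Holds {M : Type*} [L.Structure M] (φ : ParamFormula L) (x : M)
    (a : Fin φ.1 → M) : Prop :=
  φ.2.Realize (Sum.elim (fun _ => x) a)

/-- `b = ⟨b_u : u ∈ [lam]^{<ℵ₀}⟩` is a `(lam, B, T, φ)`-possibility, for a sequence
`φ = ⟨φ_i : i < lam⟩` of formulas. As the language lies in `Type`, it makes no difference that the models
are taken in `Type`. -/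
structure IsPossibility (lam : Cardinal.{u}) (T : L.Theory)
    (φ : lam.ord.ToType → ParamFormula L) (b : Finset lam.ord.ToType → B) : Prop where
  pos : ∀ u, b u ≠ ⊥
  anti : ∀ v u, v ⊆ u → b u ≤ b v
  pattern : ∀ (s : Finset lam.ord.ToType) (c : B), c ≠ ⊥ →
    (∀ u ⊆ s, c ≤ b u ∨ c ≤ (b u)ᶜ) → (∀ i ∈ s, c ≤ b {i}) →
    ∃ (M : T.ModelType.{0, 0, 0}) (a : ∀ i : lam.ord.ToType, Fin (φ i).1 → M),
      ∀ u ⊆ s, (∃ x : M, ∀ i ∈ u, (φ i).Holds x (a i)) ↔ c ≤ b u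

open Classical in
/-- `D` is `(lam, B, T, Δ)`-moral: each `(lam, B, T, φ)`-possibility, where `φ` is a sequence of
formulas from `Δ`, that consists of elements of `D` has a multiplicative refinement that consists of
elements of `D`. -/
def IsMoralFor (lam : Cardinal.{u}) (T : L.Theory) (Δ : Set (ParamFormula L))
    (D : Order.PFilter B) : Prop :=
  ∀ (φ : lam.ord.ToType → ParamFormula L) (b : Finset lam.ord.ToType → B),
    (∀ i, φ i ∈ Δ) → IsPossibility lam T φ b → (∀ u, b u ∈ D) →
    ∃ b' : Finset lam.ord.ToType → B,
      (∀ u v, b' u ⊓ b' v = b' (u ∪ v)) ∧ (∀ u, b' u ≤ b u) ∧ ∀ u, b' u ∈ D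

/-- `D` is `(lam, B, T)`-moral: the case where `Δ` is the set of all formulas. -/
def IsMoral (lam : Cardinal.{u}) (T : L.Theory) (D : Order.PFilter B) : Prop :=
  IsMoralFor lam T Set.univ D

end Moral

end MoralHyp

open scoped Cardinal

/-!
The idea is to turn the generic `(k+1)`-partite `(k+1)`-uniform hypergraph on `k+1` copies of `lam`,
with edges valued in the Boolean algebra, into a possibility, and to show that a free set for a set
mapping destroys each of its multiplicative refinements.

Let a tuple `v : Fin (k+1) → lam` stand for a transversal, with its `i`-th entry in the `i`-th copy,
and let the indices below `lam` enumerate the faces of transversals. To each `v` belongs a partition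
of its own; as the ultrafilter `D` is proper, it omits a piece `e v` of this partition. Let `b u` be
the Boolean value of the statement that no edge has all its faces in `u`, where `e v` is the value of
the statement that `v` is an edge, so that `b u ∈ D`. This is a possibility for the formula
`R(x, y_0, …, y_{k-1})` (`isPossibility_indepValue`): once a nonzero `c` decides the relevant edges,
they form a hypergraph that has no complete graph on `k+2` vertices because it is `(k+1)`-partite,
and this stays true if each independent set of faces gets an apex that is joined to these faces
(`isHyp_cone`). A set of faces that contains the faces of an edge cannot be joined to one point, as
this would form a complete graph on `k+2` vertices (`exists_model_of_hypergraph`).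

Let `b'` be a multiplicative refinement in `D`. By the chain condition of the algebra, the value of
`b'` at a single face depends on at most `mu` partitions (`exists_support`). The set mapping relation
gives a tuple `v` whose partition is none of those (`exists_tuple_avoiding`). The value of `b'` at the
set of all faces of `v` is the infimum of its values at single faces, so it does not depend on the
partition of `v` and, being nonzero, meets the piece `e v`; but it lies below `b` of the set of faces
of `v`, which is the complement of `e v` (`not_isMoral_of_setMappingArrow`).

For `lam = ℵ_(α+l)` and `mu = ℵ_α` with `l > k`, the set mapping relation is Kuratowski's free set
theorem (`exists_free_set`).
-/

namespace MoralHyp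
open Cardinal FirstOrder FirstOrder.Language

/-! ### Free sets of set mappings -/

open Classical in
/-- Kuratowski's free set theorem: on a set of size at least `mu^{+(k+1)}`, every set mapping of
`k`-element sets to sets of size at most `mu` has a free set with `k + 1` elements. By induction on
`k`: choose a subset `B` of the next smaller size and a point `a` outside `B` and outside the values
of the mapping on `B`, and apply the induction hypothesis on `B` with `a` added to all arguments. -/
theorem exists_free_set (mu : Cardinal.{u}) (hmu : ℵ₀ ≤ mu) (k : ℕ) :
    ∀ (α : Type u), Order.succ^[k + 1] mu ≤ #α → ∀ F : Finset α → Set α,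
      (∀ x : Finset α, x.card = k → #(F x) ≤ mu ∧ Disjoint (F x) ↑x) →
      ∃ X : Finset α, X.card = k + 1 ∧ ∀ x ⊆ X, x.card = k → Disjoint (F x) ↑X := by
  induction k with
  | zero =>
    intro α hα F hF
    have hlt : #(F ∅) < #α :=
      ((hF ∅ rfl).1.trans_lt (Order.lt_succ mu)).trans_le hα
    obtain ⟨a, ha⟩ : ∃ a, a ∉ F ∅ := by
      by_contra hall
      push Not at hall
      rw [Set.eq_univ_of_forall hall, mk_univ] at hlt
      exact lt_irrefl _ hlt
    refine ⟨{a}, by simp, fun x _ hx => ?_⟩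
    rw [Finset.card_eq_zero.1 hx]
    simpa using ha
  | succ k ih =>
    intro α hα F hF
    have hsucc : Order.succ^[k + 1 + 1] mu = Order.succ (Order.succ^[k + 1] mu) :=
      Function.iterate_succ_apply' _ _ _
    have hmu' : mu ≤ Order.succ^[k + 1] mu := Function.id_le_iterate_of_id_le
      (fun c => Order.le_succ c) (k + 1) mu
    obtain ⟨B, hB⟩ : ∃ B : Set α, #B = Order.succ^[k + 1] mu :=
      le_mk_iff_exists_set.1 ((Order.le_succ _).trans (hsucc ▸ hα))
    have hBinf : ℵ₀ ≤ #B := hB ▸ hmu.trans hmu'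
    have : Infinite B := infinite_iff.2 hBinf
    let C : Set α := B ∪ ⋃ w : {w : Finset B // w.card = k + 1},
      F (w.1.map (Function.Embedding.subtype _))
    have hC : #C < #α := by
      refine lt_of_le_of_lt ?_ ((Order.lt_succ _).trans_le (hsucc ▸ hα))
      rw [← hB]
      refine (mk_union_le _ _).trans (add_le_of_le hBinf le_rfl ?_)
      refine (mk_iUnion_le _).trans (mul_le_of_le hBinf ?_ ?_)
      · exact (mk_subtype_le _).trans (mk_finset_of_infinite B).le
      · refine ciSup_le' fun w => ?_
        exact (hF _ (by rw [Finset.card_map]; exact w.2)).1.trans (hB ▸ hmu')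
    obtain ⟨a, ha⟩ : ∃ a, a ∉ C := by
      by_contra hall
      push Not at hall
      rw [Set.eq_univ_of_forall hall, mk_univ] at hC
      exact lt_irrefl _ hC
    have haB : a ∉ B := fun h => ha (Or.inl h)
    let emb : B ↪ α := Function.Embedding.subtype _
    have hmap : ∀ w : Finset B, a ∉ w.map emb := by
      intro w h
      obtain ⟨b, -, rfl⟩ := Finset.mem_map.1 h
      exact haB b.2
    have hcard : ∀ w : Finset B, (insert a (w.map emb)).card = w.card + 1 := fun w => by
      rw [Finset.card_insert_of_notMem (hmap w), Finset.card_map]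
    obtain ⟨X, hX, hfree⟩ := ih B hB.ge
      (fun w => {b | (b : α) ∈ F (insert a (w.map emb))}) (by
        intro x hx
        obtain ⟨h1, h2⟩ := hF (insert a (x.map emb)) (by rw [hcard, hx])
        refine ⟨(mk_preimage_of_injective _ _ Subtype.val_injective).trans h1, ?_⟩
        rw [Set.disjoint_left]
        intro b hb hbx
        exact Set.disjoint_left.1 h2 hb
          (Finset.mem_coe.2 (Finset.mem_insert_of_mem (Finset.mem_map_of_mem emb hbx))))
    refine ⟨insert a (X.map emb), by rw [hcard, hX], fun x hx hxk => ?_⟩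
    have hxF := (hF x hxk).2
    by_cases hax : a ∈ x
    · -- such an `x` is `a` together with `k` elements of `X`
      obtain ⟨y, hyX, hy⟩ : ∃ y ⊆ X, x.erase a = y.map emb :=
        Finset.subset_map_iff.1 (by rwa [← Finset.subset_insert_iff])
      have hxy : x = insert a (y.map emb) := by rw [← hy, Finset.insert_erase hax]
      have hyk : y.card = k := by
        have := hcard y
        rw [← hxy, hxk] at this
        omega
      have hd := hfree y hyX hyk
      rw [Set.disjoint_left] at hd hxF ⊢
      intro z hz hzX
      rcases Finset.mem_insert.1 (Finset.mem_coe.1 hzX) with rfl | hzX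
      · exact hxF hz hax
      · obtain ⟨b, hb, rfl⟩ := Finset.mem_map.1 hzX
        exact hd (show (b : α) ∈ F _ from hxy ▸ hz) hb
    · -- otherwise `x` is the whole of `X`
      have hxX : x = X.map emb :=
        Finset.eq_of_subset_of_card_le ((Finset.subset_insert_iff_of_notMem hax).1 hx)
          (by rw [Finset.card_map, hX, hxk])
      rw [Set.disjoint_left] at hxF ⊢
      intro z hz hzX
      rcases Finset.mem_insert.1 (Finset.mem_coe.1 hzX) with rfl | hzX
      · exact ha (Or.inr (Set.mem_iUnion.2 ⟨⟨X, hX⟩, hxX ▸ hz⟩))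
      · exact hxF hz (hxX ▸ hzX)

theorem succ_iterate_aleph (α : Ordinal.{u}) (n : ℕ) :
    Order.succ^[n] (ℵ_ α) = ℵ_ (α + (n : Ordinal.{u})) := by
  induction n with
  | zero => simp
  | succ n ih =>
    rw [Function.iterate_succ_apply', ih, succ_aleph, Nat.cast_succ, ← add_assoc]

theorem setMappingArrow_aleph (k : ℕ) (α : Ordinal.{u}) (l : ℕ) (hl : k < l) :
    SetMappingArrow (ℵ_ (α + (l : Ordinal.{u}))) k (Order.succ (ℵ_ α)) (k + 1) := by
  intro F hF
  refine exists_free_set (ℵ_ α) (aleph0_le_aleph α) k _ ?_ F fun x hx =>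
    ⟨Order.lt_succ_iff.1 (hF x hx).1, (hF x hx).2⟩
  rw [mk_ord_toType, succ_iterate_aleph]
  exact aleph_le_aleph.2 (by gcongr; exact_mod_cast hl)

/-! ### Supports in the completion -/

section Support
variable {A M : Type u}

/-- The element of the completion of `𝔅⁰` given by the restriction of `η` to the finite set `d`. -/
def basic (d : Finset A) (η : A → M) : BoolCompletion (CylAlg A M) :=
  toCompletion (CylAlg.gen ⟨d, fun a => η a⟩)

theorem basic_le_basic {d d' : Finset A} {η η' : A → M} (hd : d' ⊆ d)
    (h : ∀ a ∈ d', η a = η' a) : basic d η ≤ basic d' η' :=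
  toCompletion_le_iff.2 (CylAlg.gen_le_gen _ _ fun a ha => ⟨hd ha, h a ha⟩)

theorem eq_of_basic_le_basic {d d' : Finset A} {η η' : A → M} (h : basic d η ≤ basic d' η') :
    ∀ a ∈ d', η a = η' a := by
  intro a ha
  have h' : CylAlg.gen (⟨d, fun a => η a⟩ : FI A M) ≤ CylAlg.gen ⟨d', fun a => η' a⟩ :=
    toCompletion_le_iff.1 h
  have hη : η ∈ (CylAlg.gen (⟨d, fun a => η a⟩ : FI A M) : Set (A → M)) := fun _ => rfl
  exact h' hη ⟨a, ha⟩

theorem basic_ne_bot (d : Finset A) (η : A → M) : basic d η ≠ ⊥ := by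
  intro h
  have hne : CylAlg.gen (⟨d, fun a => η a⟩ : FI A M) ≠ ⊥ := by
    intro e
    have he : FI.cylinder ⟨d, fun a => η a⟩ = (∅ : Set (A → M)) := congrArg Subtype.val e
    have : η ∈ FI.cylinder ⟨d, fun a => η a⟩ := fun _ => rfl
    rw [he] at this
    exact this
  have hmem : (⟨_, hne⟩ : Positive (CylAlg A M)) ∈ (basic d η : LowerSet (Positive _)) :=
    (mem_toCompletion _ _).2 le_rfl
  rw [h] at hmem
  exact hmem

theorem exists_basic_le [Nonempty M] (c : BoolCompletion (CylAlg A M)) (hc : c ≠ ⊥) :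
    ∃ d η, basic d η ≤ c := by
  classical
  obtain ⟨b, hb, hbc⟩ := exists_toCompletion_le c hc
  obtain ⟨f, hf⟩ := CylAlg.exists_gen_le b hb
  refine ⟨f.dom, fun a => if h : a ∈ f.dom then f.toFun ⟨a, h⟩ else Classical.arbitrary M, ?_⟩
  refine le_trans (toCompletion_le_iff.2 (le_trans (CylAlg.gen_le_gen _ _ ?_) hf)) hbc
  intro a ha
  exact ⟨ha, by simp [ha]⟩

/-- Two finite partial functions, given as restrictions of total functions, are compatible. -/
def Compat (p q : Finset A × (A → M)) : Prop := ∀ a ∈ p.1, a ∈ q.1 → p.2 a = q.2 a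

open Classical in
theorem Compat.not_disjoint {p q : Finset A × (A → M)} (h : Compat p q) :
    ¬ Disjoint (basic p.1 p.2) (basic q.1 q.2) := by
  intro hd
  let η : A → M := fun a => if a ∈ p.1 then p.2 a else q.2 a
  refine basic_ne_bot (p.1 ∪ q.1) η (le_bot_iff.1 (hd (basic_le_basic
    Finset.subset_union_left fun a ha => ?_) (basic_le_basic Finset.subset_union_right
      fun a ha => ?_)))
  · simp [η, ha]
  · by_cases hp : a ∈ p.1
    · simpa [η, hp] using h a hp ha
    · simp [η, hp]

open Classical in
/-- Pairwise incompatible finite partial functions with domains of size `n`, by induction on `n`: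
fixing a value at a point, these points can be removed from the domains. -/
theorem mk_antichain_le_of_card (kappa : Cardinal.{u}) (hk : ℵ₀ ≤ kappa) (hM : #M ≤ kappa) (n : ℕ) :
    ∀ (ι : Type u) (p : ι → Finset A × (A → M)), (∀ i, (p i).1.card = n) →
      (∀ i j, i ≠ j → ¬ Compat (p i) (p j)) → #ι ≤ kappa := by
  induction n with
  | zero =>
    intro ι p hp hinc
    have : Subsingleton ι := ⟨fun i j => by
      by_contra hij
      refine hinc i j hij fun a ha => ?_
      rw [Finset.card_eq_zero.1 (hp i)] at ha
      simp at ha⟩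
    exact (le_one_iff_subsingleton.2 this).trans (one_le_aleph0.trans hk)
  | succ n ih =>
    intro ι p hp hinc
    rcases isEmpty_or_nonempty ι with hι | ⟨⟨i₀⟩⟩
    · simp
    -- every other member of the family takes a value at some point of the domain of `p i₀`
    have hcov : (Set.univ : Set ι) ⊆ {i₀} ∪ ⋃ x : (p i₀).1 × M,
        {i | x.1.1 ∈ (p i).1 ∧ (p i).2 x.1.1 = x.2} := by
      intro i _
      by_cases hi : i₀ = i
      · exact Or.inl hi.symm
      · have := hinc i₀ i hi
        simp only [Compat, not_forall] at this
        obtain ⟨a, ha, ha', -⟩ := this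
        exact Or.inr (Set.mem_iUnion.2 ⟨(⟨a, ha⟩, (p i).2 a), ha', rfl⟩)
    rw [← mk_univ]
    refine (mk_le_mk_of_subset hcov).trans ((mk_union_le _ _).trans (add_le_of_le hk ?_ ?_))
    · rw [mk_singleton]
      exact one_le_aleph0.trans hk
    refine (mk_iUnion_le _).trans (mul_le_of_le hk ?_ (ciSup_le' fun x => ?_))
    · rw [mk_prod, lift_id, lift_id]
      exact mul_le_of_le hk ((lt_aleph0_of_finite _).le.trans hk) hM
    · refine ih _ (fun i => ((p i.1).1.erase x.1.1, (p i.1).2)) (fun i => ?_) fun i j hij hc => ?_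
      · rw [Finset.card_erase_of_mem i.2.1, hp, Nat.add_sub_cancel]
      · refine hinc i.1 j.1 (fun e => hij (Subtype.ext e)) fun a hai haj => ?_
        by_cases hax : a = x.1.1
        · rw [hax, i.2.2, j.2.2]
        · exact hc a (Finset.mem_erase.2 ⟨hax, hai⟩) (Finset.mem_erase.2 ⟨hax, haj⟩)

/-- The algebra `𝔅⁰` has the `κ⁺`-chain condition if its partitions have at most `κ` pieces. -/
theorem mk_antichain_le (kappa : Cardinal.{u}) (hk : ℵ₀ ≤ kappa) (hM : #M ≤ kappa)
    (S : Set (Finset A × (A → M))) (hS : S.Pairwise fun p q => ¬ Compat p q) : #S ≤ kappa := by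
  have hcov : S ⊆ ⋃ n : ULift.{u} ℕ, {p ∈ S | p.1.card = n.down} := fun p hp =>
    Set.mem_iUnion.2 ⟨⟨p.1.card⟩, hp, rfl⟩
  refine (mk_le_mk_of_subset hcov).trans ((mk_iUnion_le _).trans
    (mul_le_of_le hk (by simpa using hk) (ciSup_le' fun n => ?_)))
  exact mk_antichain_le_of_card kappa hk hM n.down _ (fun p => p.1) (fun p => p.2.2)
    fun p q hpq => hS p.2.1 q.2.1 fun e => hpq (Subtype.ext e)

open Classical in
/-- The element `b` of the completion does not depend on the partition with index `a`. -/
def NotDependsOn (a : A) (b : BoolCompletion (CylAlg A M)) : Prop :=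
  ∀ (d : Finset A) (η : A → M), basic d η ≤ b → basic (d.erase a) η ≤ b

open Classical in
/-- Every element of the completion depends on few partitions only: those that occur in a maximal
antichain below it. -/
theorem exists_support [Nonempty M] (kappa : Cardinal.{u}) (hk : ℵ₀ ≤ kappa) (hM : #M ≤ kappa)
    (b : BoolCompletion (CylAlg A M)) :
    ∃ S : Set A, #S ≤ kappa ∧ ∀ a ∉ S, NotDependsOn a b := by
  obtain ⟨𝒜, h𝒜⟩ := zorn_subset
    {S : Set (Finset A × (A → M)) | (∀ p ∈ S, basic p.1 p.2 ≤ b) ∧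
      S.Pairwise fun p q => ¬ Compat p q} (by
    intro c hc hchain
    refine ⟨⋃₀ c, ⟨?_, ?_⟩, fun s hs => Set.subset_sUnion_of_mem hs⟩
    · rintro p ⟨s, hs, hp⟩
      exact (hc hs).1 p hp
    · exact (Set.pairwise_sUnion hchain.directedOn).2 fun s hs => (hc hs).2)
  have hmem : ∀ p : Finset A × (A → M), basic p.1 p.2 ≤ b → ∃ q ∈ 𝒜, Compat p q := by
    intro p hp
    by_contra hno
    push Not at hno
    have hp𝒜 : p ∈ 𝒜 := by
      refine h𝒜.le_of_ge (y := insert p 𝒜) ⟨?_, ?_⟩ (Set.subset_insert _ _)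
        (Set.mem_insert _ _)
      · rintro q (rfl | hq)
        · exact hp
        · exact h𝒜.prop.1 q hq
      · exact Set.pairwise_insert.2 ⟨h𝒜.prop.2, fun q hq _ =>
          ⟨hno q hq, fun h => hno q hq fun a ha hb => (h a hb ha).symm⟩⟩
    exact hno p hp𝒜 fun _ _ _ => rfl
  refine ⟨⋃ p : 𝒜, (p.1.1 : Set A), ?_, fun a ha d η hd => ?_⟩
  · refine (mk_iUnion_le _).trans (mul_le_of_le hk (mk_antichain_le kappa hk hM 𝒜 h𝒜.prop.2)
      (ciSup_le' fun p => ?_))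
    exact (lt_aleph0_of_finite _).le.trans hk
  by_contra hnot
  obtain ⟨d₂, η₂, h₂⟩ := exists_basic_le (basic (d.erase a) η ⊓ bᶜ) (fun e => hnot
    (disjoint_compl_right_iff.1 (disjoint_iff.2 e)))
  have heq := eq_of_basic_le_basic (h₂.trans inf_le_left)
  -- changing `η₂` at `a` alone leads below `b`
  obtain ⟨q, hq, hc⟩ := hmem (d₂ ∪ d, Function.update η₂ a (η a)) (by
    refine (basic_le_basic Finset.subset_union_right fun x hx => ?_).trans hd
    by_cases hxa : x = a
    · subst hxa; simp
    · refine (Function.update_of_ne hxa _ _).trans ?_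
      exact heq x (Finset.mem_erase.2 ⟨hxa, hx⟩))
  refine Compat.not_disjoint (p := (d₂, η₂)) (q := q) (fun x hx hxq => ?_)
    ((disjoint_compl_left (a := b)).mono (h₂.trans inf_le_right) (h𝒜.prop.1 q hq))
  have hxa : x ≠ a := fun e => ha (Set.mem_iUnion.2 ⟨⟨q, hq⟩, e ▸ hxq⟩)
  have := hc x (Finset.mem_union_left _ hx) hxq
  exact (Function.update_of_ne hxa _ _).symm.trans this

theorem NotDependsOn.finset_inf {ι : Type*} {a : A} (s : Finset ι)
    (f : ι → BoolCompletion (CylAlg A M)) (h : ∀ i ∈ s, NotDependsOn a (f i)) :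
    NotDependsOn a (s.inf f) := fun d η hd =>
  Finset.le_inf fun i hi => h i hi d η (hd.trans (Finset.inf_le hi))

/-- A nonzero element that does not depend on a partition meets all of its pieces. -/
theorem NotDependsOn.not_disjoint [Nonempty M] {a : A} {b : BoolCompletion (CylAlg A M)}
    (h : NotDependsOn a b) (hb : b ≠ ⊥) (η : A → M) : ¬ Disjoint b (basic {a} η) := by
  classical
  intro hd
  obtain ⟨d, θ, hdθ⟩ := exists_basic_le b hb
  refine Compat.not_disjoint (p := (d.erase a, θ)) (q := ({a}, η)) (fun x hx hxa => ?_)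
    (hd.mono_left (h d θ hdθ))
  exact absurd (Finset.mem_singleton.1 hxa) (Finset.ne_of_mem_erase hx)

end Support

/-! ### Faces of tuples -/

section Faces
variable {k : ℕ} {α : Type*}

/-- The `j`-th face of a `(k+1)`-tuple: the index `j` together with the `k`-tuple obtained by
omitting the `j`-th entry. -/
def face (v : Fin (k + 1) → α) (j : Fin (k + 1)) : Fin (k + 1) × (Fin k → α) :=
  (j, v ∘ j.succAbove)

theorem cons_comp_succ_succAbove (y : α) (v : Fin (k + 1) → α) (j : Fin (k + 1)) :
    (Fin.cons y v : Fin (k + 2) → α) ∘ j.succ.succAbove =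
      (Fin.cons y (v ∘ j.succAbove) : Fin (k + 1) → α) := by
  funext i
  refine Fin.cases ?_ (fun i => ?_) i
  · simp
  · simp

theorem exists_succAbove_apply_eq (hk : 1 ≤ k) (i : Fin (k + 1)) :
    ∃ (j : Fin (k + 1)) (i' : Fin k), j.succAbove i' = i := by
  have : Nontrivial (Fin (k + 1)) := Fin.nontrivial_iff_two_le.2 (by omega)
  obtain ⟨j, hj⟩ := exists_ne i
  exact ⟨j, Fin.exists_succAbove_eq hj.symm⟩

theorem eq_of_face_eq (hk : 1 ≤ k) {v v' : Fin (k + 1) → α} (h : ∀ j, face v j = face v' j) :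
    v = v' := by
  funext i
  obtain ⟨j, i', rfl⟩ := exists_succAbove_apply_eq hk i
  exact congrFun (Prod.ext_iff.1 (h j)).2 i'

theorem eq_of_forall_face_mem (hk : 1 ≤ k) {v v' : Fin (k + 1) → α}
    (h : ∀ j, ∃ j', face v' j = face v j') : v' = v := by
  refine eq_of_face_eq hk fun j => ?_
  obtain ⟨j', hj'⟩ := h j
  obtain rfl : j = j' := (Prod.ext_iff.1 hj').1
  exact hj'

/-- A tuple with at least three entries is injective if all the tuples obtained by omitting one
entry are. -/
theorem injective_of_comp_succAbove (hk : 1 ≤ k) {z : Fin (k + 2) → α}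
    (h : ∀ J : Fin (k + 2), Function.Injective (z ∘ J.succAbove)) : Function.Injective z := by
  intro i i' hii
  obtain ⟨J, hJ⟩ : ∃ J, J ∉ ({i, i'} : Finset (Fin (k + 2))) := by
    by_contra hall
    push Not at hall
    have h1 := Finset.card_le_card (fun x _ => hall x : Finset.univ ⊆ _)
    have h2 := Finset.card_le_two (a := i) (b := i')
    rw [Finset.card_univ, Fintype.card_fin] at h1
    omega
  simp only [Finset.mem_insert, Finset.mem_singleton, not_or] at hJ
  obtain ⟨a, rfl⟩ := Fin.exists_succAbove_eq (Ne.symm hJ.1)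
  obtain ⟨b, rfl⟩ := Fin.exists_succAbove_eq (Ne.symm hJ.2)
  rw [h J hii]

/-- An injection `Fin (k + 1) → Fin (k + 2)` is a coface map up to a permutation. -/
theorem exists_eq_succAbove_comp (g : Fin (k + 1) ↪ Fin (k + 2)) :
    ∃ (J : Fin (k + 2)) (σ : Equiv.Perm (Fin (k + 1))), ⇑g = J.succAbove ∘ σ := by
  obtain ⟨J, hJ⟩ : ∃ J, ∀ i, g i ≠ J := by
    by_contra hall
    push Not at hall
    have := Fintype.card_le_of_surjective g hall
    simp at this
  choose σ hσ using fun i => Fin.exists_succAbove_eq (hJ i)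
  have hinj : Function.Injective σ := fun i i' h => g.injective (by rw [← hσ, ← hσ, h])
  exact ⟨J, Equiv.ofBijective σ (Finite.injective_iff_bijective.1 hinj),
    funext fun i => (hσ i).symm⟩

theorem eq_of_succAbove_comp_eq {J J' : Fin (k + 2)} {σ : Equiv.Perm (Fin (k + 1))}
    (h : J.succAbove ∘ σ = J'.succAbove) : J = J' ∧ ⇑σ = id := by
  have hJ : J = J' := by
    have h1 : Set.range (J.succAbove ∘ σ) = Set.range J'.succAbove := by rw [h]
    rw [σ.surjective.range_comp, Fin.range_succAbove, Fin.range_succAbove] at h1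
    exact Set.singleton_injective (compl_injective h1)
  subst hJ
  exact ⟨rfl, funext fun i => Fin.succAbove_right_injective (congrFun h i)⟩

end Faces

/-! ### Multipartite hypergraphs with cones -/

section Cone
variable {k : ℕ} {V : Type} (E : (Fin (k + 1) → V) → Prop)

/-- A set of faces is independent if it does not contain all faces of an edge. -/
def IsIndepFaces (x : Set (Fin (k + 1) × (Fin k → V))) : Prop :=
  ∀ v, (∀ j, face v j ∈ x) → ¬ E v

/-- The vertices of the cone hypergraph: `k+1` disjoint copies of `V`, and a further vertex for each
independent set of faces. -/
def ConeVertex : Type :=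
  (V × Fin (k + 1)) ⊕ {x : Set (Fin (k + 1) × (Fin k → V)) // IsIndepFaces E x}

/-- The vertex `y` in the `i`-th copy of `V`. -/
def ConeVertex.base (y : V) (i : Fin (k + 1)) : ConeVertex E := Sum.inl (y, i)

/-- The vertex given by an independent set of faces. -/
def ConeVertex.apex (x : Set (Fin (k + 1) × (Fin k → V))) (hx : IsIndepFaces E x) : ConeVertex E :=
  Sum.inr ⟨x, hx⟩

/-- The colour of a vertex: `0` for apexes and `i + 1` for the `i`-th copy of `V`. -/
def ConeVertex.col : ConeVertex E → Fin (k + 2) :=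
  Sum.elim (fun p => p.2.succ) fun _ => 0

/-- The edges of the cone hypergraph, enumerated with increasing colours: the edges `v` of `E`, with
the `i`-th entry in the `i`-th copy, and the sets consisting of an apex and one of its faces. -/
def IsConeEdge (t : Fin (k + 1) → ConeVertex E) : Prop :=
  (∃ v, E v ∧ t = fun i => ConeVertex.base E (v i) i) ∨
  ∃ (x : _) (hx : IsIndepFaces E x) (j : Fin (k + 1)) (w : Fin k → V), (j, w) ∈ x ∧
    t = (Fin.cons (ConeVertex.apex E x hx) fun i => ConeVertex.base E (w i) (j.succAbove i) :
      Fin (k + 1) → ConeVertex E)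

instance coneStructure : (hypLang k).Structure (ConeVertex E) where
  funMap f _ := f.elim
  RelMap {n} R := match n, R with
    | _, HypRel.edge => fun t => ∃ σ : Equiv.Perm (Fin (k + 1)), IsConeEdge E (t ∘ σ)

theorem edge_cone_iff (t : Fin (k + 1) → ConeVertex E) :
    Edge k t ↔ ∃ σ : Equiv.Perm (Fin (k + 1)), IsConeEdge E (t ∘ σ) := Iff.rfl

variable {E}

theorem IsConeEdge.edge {t : Fin (k + 1) → ConeVertex E} (h : IsConeEdge E t) : Edge k t :=
  (edge_cone_iff E t).2 ⟨1, h⟩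

theorem col_base (v : Fin (k + 1) → V) :
    (ConeVertex.col E ∘ fun i => ConeVertex.base E (v i) i) = (0 : Fin (k + 2)).succAbove :=
  Fin.succAbove_zero.symm

theorem col_cone {x : Set (Fin (k + 1) × (Fin k → V))} (hx : IsIndepFaces E x)
    (j : Fin (k + 1)) (w : Fin k → V) :
    ConeVertex.col E ∘ (Fin.cons (ConeVertex.apex E x hx) fun i =>
      ConeVertex.base E (w i) (j.succAbove i) : Fin (k + 1) → ConeVertex E) =
        j.succ.succAbove := by
  funext i
  refine Fin.cases ?_ (fun i => ?_) i
  · rw [Fin.succ_succAbove_zero]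
    rfl
  · rw [Fin.succ_succAbove_succ]
    rfl

theorem IsConeEdge.exists_col {t : Fin (k + 1) → ConeVertex E} (h : IsConeEdge E t) :
    ∃ J : Fin (k + 2), ConeVertex.col E ∘ t = J.succAbove := by
  rcases h with ⟨v, -, rfl⟩ | ⟨x, hx, j, w, -, rfl⟩
  · exact ⟨0, col_base v⟩
  · exact ⟨j.succ, col_cone hx j w⟩

theorem injective_col_of_edge {t : Fin (k + 1) → ConeVertex E} (h : Edge k t) :
    Function.Injective (ConeVertex.col E ∘ t) := by
  obtain ⟨σ, hσ⟩ := (edge_cone_iff E t).1 h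
  obtain ⟨J, hJ⟩ := hσ.exists_col
  have h2 : Function.Injective ((ConeVertex.col E ∘ t) ∘ σ) := by
    rw [Function.comp_assoc, hJ]
    exact Fin.succAbove_right_injective
  exact (Function.Injective.of_comp_iff' _ σ.bijective).1 h2

/-- An edge whose vertices are listed with increasing colours is listed in the standard way. -/
theorem isConeEdge_of_col {t : Fin (k + 1) → ConeVertex E} (h : Edge k t) {J : Fin (k + 2)}
    (hJ : ConeVertex.col E ∘ t = J.succAbove) : IsConeEdge E t := by
  obtain ⟨σ, hσ⟩ := (edge_cone_iff E t).1 h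
  obtain ⟨J', hJ'⟩ := hσ.exists_col
  rw [← Function.comp_assoc, hJ] at hJ'
  have := (eq_of_succAbove_comp_eq hJ').2
  rwa [this, Function.comp_id] at hσ

theorem ConeVertex.exists_base_of_col {a : ConeVertex E} {i : Fin (k + 1)}
    (h : ConeVertex.col E a = i.succ) : ∃ y, a = ConeVertex.base E y i := by
  rcases a with ⟨y, i'⟩ | x
  · exact ⟨y, by rw [← Fin.succ_injective _ h]; rfl⟩
  · exact absurd h.symm (Fin.succ_ne_zero i)

theorem ConeVertex.exists_apex_of_col {a : ConeVertex E} (h : ConeVertex.col E a = 0) :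
    ∃ x hx, a = ConeVertex.apex E x hx := by
  rcases a with ⟨y, i'⟩ | ⟨x, hx⟩
  · exact absurd h (Fin.succ_ne_zero i')
  · exact ⟨x, hx, rfl⟩

theorem ConeVertex.base_injective {y y' : V} {i i' : Fin (k + 1)}
    (h : ConeVertex.base E y i = ConeVertex.base E y' i') : y = y' :=
  (Prod.ext_iff.1 (Sum.inl_injective h)).1

theorem base_edge_iff {v : Fin (k + 1) → V} :
    Edge k (fun i => ConeVertex.base E (v i) i) ↔ E v := by
  refine ⟨fun h => ?_, fun h => IsConeEdge.edge (Or.inl ⟨v, h, rfl⟩)⟩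
  rcases isConeEdge_of_col h (col_base v) with ⟨v', hv', e⟩ | ⟨x, hx, j, w, -, e⟩
  · rwa [show v = v' from funext fun i => ConeVertex.base_injective (congrFun e i)]
  · exact (Sum.inl_ne_inr (congrFun e 0)).elim

theorem apex_edge_iff {x : Set (Fin (k + 1) × (Fin k → V))} {hx : IsIndepFaces E x}
    {j : Fin (k + 1)} {w : Fin k → V} :
    Edge k (Fin.cons (ConeVertex.apex E x hx) fun i => ConeVertex.base E (w i) (j.succAbove i) :
      Fin (k + 1) → ConeVertex E) ↔ (j, w) ∈ x := by
  refine ⟨fun h => ?_, fun h => IsConeEdge.edge (Or.inr ⟨x, hx, j, w, h, rfl⟩)⟩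
  rcases isConeEdge_of_col h (col_cone hx j w) with ⟨v', -, e⟩ | ⟨x', hx', j', w', hw', e⟩
  · exact (Sum.inl_ne_inr (congrFun e 0).symm).elim
  · have hj : j = j' := by
      have := col_cone hx j w
      rw [e, col_cone hx' j' w'] at this
      exact (Fin.succ_injective _ (Fin.succAbove_left_injective this)).symm
    subst hj
    obtain rfl : x = x' := Subtype.ext_iff.1 (Sum.inr_injective (congrFun e 0))
    rwa [show w = w' from funext fun i => ConeVertex.base_injective (congrFun e i.succ)]

/-- In the cone hypergraph any two vertices of a complete graph have different colours, so a complete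
graph on `k+2` vertices would consist of an apex and an edge all of whose faces belong to the apex. -/
theorem isHyp_cone (hk : 1 ≤ k) : IsHyp (k + 1) k (ConeVertex E) := by
  refine ⟨fun σ t ht => ?_, fun t ht => (injective_col_of_edge ht).of_comp, fun z hz hcl => ?_⟩
  · obtain ⟨τ, hτ⟩ := (edge_cone_iff E t).1 ht
    refine (edge_cone_iff E _).2 ⟨σ⁻¹ * τ, ?_⟩
    rwa [Function.comp_assoc, ← Equiv.Perm.coe_mul, mul_inv_cancel_left]
  · have hcol : Function.Injective (ConeVertex.col E ∘ z) :=
      injective_of_comp_succAbove hk fun J => injective_col_of_edge (hcl J.succAboveEmb)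
    let τ : Equiv.Perm (Fin (k + 2)) :=
      (Equiv.ofBijective _ (Finite.injective_iff_bijective.1 hcol)).symm
    have hτ : ∀ J, ConeVertex.col E (z (τ J)) = J := fun J =>
      (Equiv.ofBijective _ (Finite.injective_iff_bijective.1 hcol)).apply_symm_apply J
    have hedge : ∀ J : Fin (k + 2), Edge k (fun i => z (τ (J.succAbove i))) := fun J =>
      hcl (J.succAboveEmb.trans τ.toEmbedding)
    obtain ⟨x, hx, hx0⟩ := ConeVertex.exists_apex_of_col (hτ 0)
    choose v hv using fun i : Fin (k + 1) => ConeVertex.exists_base_of_col (hτ i.succ)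
    refine hx v (fun j => ?_) (base_edge_iff.1 ?_)
    · refine (apex_edge_iff (hx := hx)).1 ?_
      have hz : z ∘ τ = Fin.cons (ConeVertex.apex E x hx) fun i => ConeVertex.base E (v i) i := by
        funext J
        refine Fin.cases ?_ (fun i => ?_) J
        · exact hx0
        · exact hv i
      have := hedge j.succ
      change Edge k ((z ∘ τ) ∘ j.succ.succAbove) at this
      rwa [hz, cons_comp_succ_succAbove] at this
    · convert hedge 0 using 1
      funext i
      rw [Fin.succAbove_zero, hv]

end Cone

/-- Every `(k+1)`-partite hypergraph `E` on copies of `V` is realized in a model of the model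
completion in such a way that a set of formulas `R(x, p(w))`, for faces `w`, is satisfied by some `x`
if and only if the set does not contain all faces of an edge. -/
theorem exists_model_of_hypergraph {k : ℕ} (hk : 1 ≤ k) {T : (hypLang k).Theory}
    (hT : IsModelCompletion (hypTheory (k + 1) k) T) {V : Type} (E : (Fin (k + 1) → V) → Prop) :
    ∃ (N : T.ModelType.{0, 0, 0}) (p : V → Fin (k + 1) → N),
      ∀ x : Set (Fin (k + 1) × (Fin k → V)),
        (∃ y : N, ∀ q ∈ x, Edge k (Fin.cons y fun i => p (q.2 i) (q.1.succAbove i) :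
          Fin (k + 1) → N)) ↔ IsIndepFaces E x := by
  have : Nonempty (ConeVertex E) := ⟨ConeVertex.apex E ∅ fun v h => (h 0).elim⟩
  have : ConeVertex E ⊨ hypTheory (k + 1) k := models_hypTheory_iff.2 (isHyp_cone hk)
  obtain ⟨N, ⟨f⟩⟩ := hT.extend (Theory.ModelType.of _ (ConeVertex E))
  have hN := models_hypTheory_iff.1 (hT.models N)
  let f' : ConeVertex E → N := f
  have hf' : Function.Injective f' := f.injective
  have hf : ∀ t : Fin (k + 1) → ConeVertex E, Edge k (f' ∘ t) ↔ Edge k t :=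
    fun t => f.map_rel (edgeSym k) t
  refine ⟨N, fun y i => f' (ConeVertex.base E y i), fun x => ⟨?_, fun hx => ?_⟩⟩
  · rintro ⟨y, hy⟩ v hv hE
    let z : Fin (k + 2) → N := Fin.cons y fun i => f' (ConeVertex.base E (v i) i)
    have hedge : ∀ J : Fin (k + 2), Edge k (z ∘ J.succAbove) := by
      intro J
      refine Fin.cases ?_ (fun j => ?_) J
      · have := (hf _).2 (base_edge_iff.2 hE)
        convert this using 1
        funext i
        simp [z]
      · rw [cons_comp_succ_succAbove]
        exact hy _ (hv j)
    refine hN.free z (injective_of_comp_succAbove hk fun J => hN.irrefl _ (hedge J)) fun g => ?_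
    obtain ⟨J, σ, hg⟩ := exists_eq_succAbove_comp g
    rw [hg, ← Function.comp_assoc]
    exact hN.symm σ _ (hedge J)
  · refine ⟨f' (ConeVertex.apex E x hx), fun q hq => ?_⟩
    have := (hf _).2 ((apex_edge_iff (hx := hx)).2 hq)
    convert this using 1
    funext i
    refine Fin.cases ?_ (fun i => ?_) i <;> rfl

/-! ### The possibility pattern of a hypergraph -/

section Pattern
variable {k : ℕ} {α ι : Type u} {B : Type u} [BooleanAlgebra B]

theorem finite_faces_subset (hk : 1 ≤ k) (π : ι ≃ Fin (k + 1) × (Fin k → α)) (u : Finset ι) :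
    {v : Fin (k + 1) → α | ∀ j, π.symm (face v j) ∈ u}.Finite := by
  refine Set.Finite.of_finite_image (f := fun v j => π.symm (face v j)) ?_ ?_
  · refine (Set.Finite.pi' (ι := Fin (k + 1)) fun _ => u.finite_toSet).subset ?_
    rintro _ ⟨v, hv, rfl⟩
    exact hv
  · intro v _ v' _ h
    exact eq_of_face_eq hk fun j => π.symm.injective (congrFun h j)

/-- For Boolean values `e v` of the edges of a `(k+1)`-partite hypergraph on copies of `α`, and an
enumeration `π` of the possible faces, the Boolean value of the statement that the faces with
indices in `u` form an independent set. -/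
noncomputable def indepValue (hk : 1 ≤ k) (π : ι ≃ Fin (k + 1) × (Fin k → α))
    (e : (Fin (k + 1) → α) → B) (u : Finset ι) : B :=
  (finite_faces_subset hk π u).toFinset.inf fun v => (e v)ᶜ

variable (hk : 1 ≤ k) (π : ι ≃ Fin (k + 1) × (Fin k → α)) (e : (Fin (k + 1) → α) → B)

theorem le_indepValue_iff (u : Finset ι) (c : B) :
    c ≤ indepValue hk π e u ↔ ∀ v, (∀ j, π.symm (face v j) ∈ u) → c ≤ (e v)ᶜ := by
  simp [indepValue, Finset.le_inf_iff]

theorem indepValue_anti {u u' : Finset ι} (h : u ⊆ u') :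
    indepValue hk π e u' ≤ indepValue hk π e u :=
  (le_indepValue_iff hk π e u _).2 fun v hv =>
    (le_indepValue_iff hk π e u' _).1 le_rfl v fun j => h (hv j)

/-- The faces of a tuple are the faces of no other tuple, so they are independent unless the tuple
is an edge. -/
theorem indepValue_faces {_ : DecidableEq ι} (v : Fin (k + 1) → α) :
    indepValue hk π e (Finset.univ.image fun j => π.symm (face v j)) = (e v)ᶜ := by
  refine eq_of_forall_le_iff fun c => ?_
  rw [le_indepValue_iff]
  refine ⟨fun h => h v fun j => Finset.mem_image_of_mem _ (Finset.mem_univ j), ?_⟩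
  intro h v' hv'
  obtain rfl : v' = v := eq_of_forall_face_mem hk fun j => by
    obtain ⟨j', -, hj'⟩ := Finset.mem_image.1 (hv' j)
    exact ⟨j', (π.symm.injective hj').symm⟩
  exact h

/-- If `c` decides all the values of subsets of `s`, then `c` decides which of the possible edges
with faces in `s` are edges. -/
theorem le_indepValue_iff_of_decides {s : Finset ι} {c : B} (hc : c ≠ ⊥)
    (hdec : ∀ u ⊆ s, c ≤ indepValue hk π e u ∨ c ≤ (indepValue hk π e u)ᶜ) {u : Finset ι}
    (hu : u ⊆ s) :
    c ≤ indepValue hk π e u ↔ ∀ v, (∀ j, π.symm (face v j) ∈ u) → ¬ c ≤ e v := by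
  classical
  rw [le_indepValue_iff]
  refine forall_congr' fun v => imp_congr_right fun hv => ⟨fun h h' => hc ?_, fun h => ?_⟩
  · exact le_bot_iff.1 ((disjoint_compl_right (a := e v)) h' h)
  · have := hdec (Finset.univ.image fun j => π.symm (face v j)) (by
      intro i hi
      obtain ⟨j, -, rfl⟩ := Finset.mem_image.1 hi
      exact hu (hv j))
    rw [indepValue_faces, compl_compl] at this
    exact this.resolve_right h

end Pattern

/-- The formula `R(x, y_0, …, y_{k-1})`. -/
def coneFormula (k : ℕ) : ParamFormula (hypLang k) :=
  ⟨k, edgeFormula (Fin.cons (Sum.inl ()) fun i => Sum.inr i)⟩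

theorem coneFormula_holds {k : ℕ} {N : Type*} [(hypLang k).Structure N] (x : N) (a : Fin k → N) :
    (coneFormula k).Holds x a ↔ Edge k (Fin.cons x a : Fin (k + 1) → N) := by
  refine (realize_edgeFormula _ _).trans (iff_of_eq (congrArg _ ?_))
  funext i
  refine Fin.cases ?_ (fun i => ?_) i <;> rfl

theorem isPossibility_indepValue {k : ℕ} (hk : 1 ≤ k) {T : (hypLang k).Theory}
    (hT : IsModelCompletion (hypTheory (k + 1) k) T) {lam : Cardinal.{u}} {B : Type u}
    [BooleanAlgebra B] {α : Type u} [Nonempty α] (π : lam.ord.ToType ≃ Fin (k + 1) × (Fin k → α))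
    (e : (Fin (k + 1) → α) → B) (hpos : ∀ u, indepValue hk π e u ≠ ⊥) :
    IsPossibility lam T (fun _ => coneFormula k) (indepValue hk π e) := by
  classical
  refine ⟨hpos, fun v u h => indepValue_anti hk π e h, fun s c hc hdec _ => ?_⟩
  -- the finitely many elements of `α` that occur in `s` are renamed as numbers
  obtain ⟨S, hSne, hS⟩ : ∃ S : Finset α, S.Nonempty ∧ ∀ q ∈ s, ∀ i, (π q).2 i ∈ S :=
    ⟨insert (Classical.arbitrary α) (s.biUnion fun q => Finset.univ.image (π q).2),
      Finset.insert_nonempty _ _, fun q hq i => Finset.mem_insert_of_mem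
        (Finset.mem_biUnion.2 ⟨q, hq, Finset.mem_image_of_mem _ (Finset.mem_univ i)⟩)⟩
  have : NeZero S.card := ⟨hSne.card_pos.ne'⟩
  let r : Fin S.card → α := fun y => (S.equivFin.symm y : α)
  have hr : Function.Injective r := Subtype.val_injective.comp S.equivFin.symm.injective
  have hrS : ∀ y ∈ S, ∃ z, r z = y := fun y hy => ⟨S.equivFin ⟨y, hy⟩, by simp [r]⟩
  obtain ⟨N, p, hp⟩ := exists_model_of_hypergraph hk hT (V := Fin S.card)
    fun v => c ≤ e (r ∘ v)
  choose! t ht using hrS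
  have htr : ∀ y, t (r y) = y := fun y => hr (ht _ (S.equivFin.symm y).2)
  refine ⟨N, fun q i => p (t ((π q).2 i)) ((π q).1.succAbove i), fun u hu => ?_⟩
  rw [le_indepValue_iff_of_decides hk π e hc hdec hu]
  trans IsIndepFaces (fun v : Fin (k + 1) → Fin S.card => c ≤ e (r ∘ v))
    {q | π.symm (q.1, r ∘ q.2) ∈ u}
  · rw [← hp]
    refine exists_congr fun x => ⟨fun h q hq => ?_, fun h q hq => ?_⟩
    · have := (coneFormula_holds _ _).1 (h _ hq)
      simp only [Equiv.apply_symm_apply] at this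
      change Edge k (Fin.cons x fun i => p ((t ∘ r ∘ q.2) i) (q.1.succAbove i)) at this
      rwa [show t ∘ r ∘ q.2 = q.2 from funext fun i => htr _] at this
    · refine (coneFormula_holds _ _).2 (h ((π q).1, t ∘ (π q).2) ?_)
      have : r ∘ t ∘ (π q).2 = (π q).2 := funext fun i => ht _ (hS q (hu hq) i)
      simpa [this] using hq
  · constructor
    · intro h v hv
      have hvS : ∀ i, v i ∈ S := fun i => by
        obtain ⟨j, i', rfl⟩ := exists_succAbove_apply_eq hk i
        simpa [face] using hS _ (hu (hv j)) i'
      have hrt : r ∘ t ∘ v = v := funext fun i => ht _ (hvS i)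
      have := h (t ∘ v)
      simp only [hrt] at this
      refine this fun j => ?_
      have hj : r ∘ (face (t ∘ v) j).2 = v ∘ j.succAbove := congrArg (· ∘ j.succAbove) hrt
      exact show π.symm (j, r ∘ (face (t ∘ v) j).2) ∈ u from hj ▸ hv j
    · intro h v hv
      exact h (r ∘ v) hv

/-! ### Multiplicative refinements -/

theorem exists_basic_compl_mem {A M : Type u} [Nontrivial M]
    {D : Order.PFilter (BoolCompletion (CylAlg A M))} (hD : IsUltra D) (a : A) :
    ∃ η : A → M, (basic {a} η)ᶜ ∈ D := by
  obtain ⟨m, m', hm⟩ := exists_pair_ne M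
  by_contra hno
  push Not at hno
  have h1 := (hD.2 (basic {a} fun _ => m)).resolve_right (hno _)
  refine hno (fun _ => m') (D.mem_of_le (le_compl_iff_disjoint_right.2 ?_) h1)
  rw [disjoint_iff]
  by_contra hne
  obtain ⟨d, η, h⟩ := exists_basic_le _ hne
  have e1 := eq_of_basic_le_basic (h.trans inf_le_left) a (Finset.mem_singleton_self a)
  have e2 := eq_of_basic_le_basic (h.trans inf_le_right) a (Finset.mem_singleton_self a)
  exact hm (e1.symm.trans e2)

theorem inf_singleton_eq_of_multiplicative {B ι : Type*} {_ : DecidableEq ι} [BooleanAlgebra B]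
    {b : Finset ι → B}
    (hb : ∀ u v, b u ⊓ b v = b (u ∪ v)) {u : Finset ι} (hu : u.Nonempty) :
    u.inf (fun i => b {i}) = b u := by
  induction hu using Finset.Nonempty.cons_induction with
  | singleton i => simp
  | cons i s hi hs ih => rw [Finset.cons_eq_insert, Finset.inf_insert, ih, hb]; rfl

/-- If each face forbids at most `μ` tuples, then some tuple is forbidden by none of its faces. It is
an enumeration of a free set for the set mapping that takes a `k`-element set `w` to the entries of
the tuples that are forbidden by faces with entries in `w`. -/
theorem exists_tuple_avoiding {k : ℕ} {lam mu : Cardinal.{u}} (hmu : ℵ₀ ≤ mu)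
    (h : SetMappingArrow lam k (Order.succ mu) (k + 1))
    (S : Fin (k + 1) × (Fin k → lam.ord.ToType) → Set (Fin (k + 1) → lam.ord.ToType))
    (hS : ∀ q, #(S q) ≤ mu) :
    ∃ v : Fin (k + 1) → lam.ord.ToType, ∀ j, v ∉ S (face v j) := by
  classical
  let F : Finset lam.ord.ToType → Set lam.ord.ToType := fun w =>
    (⋃ q : {q : Fin (k + 1) × (Fin k → lam.ord.ToType) // ∀ i, q.2 i ∈ w},
      ⋃ v : S q.1, Set.range v.1) \ w
  have hF : ∀ w, #(F w) ≤ mu := by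
    intro w
    have hfin : Finite {q : Fin (k + 1) × (Fin k → lam.ord.ToType) // ∀ i, q.2 i ∈ w} := by
      refine Finite.of_injective (β := Fin (k + 1) × (Fin k → w))
        (fun q => (q.1.1, fun i => ⟨q.1.2 i, q.2 i⟩)) fun q q' e => ?_
      refine Subtype.ext (Prod.ext (Prod.ext_iff.1 e).1 (funext fun i => ?_))
      exact congrArg Subtype.val (congrFun (Prod.ext_iff.1 e).2 i)
    refine (mk_le_mk_of_subset Set.sdiff_subset).trans ((mk_iUnion_le _).trans
      (mul_le_of_le hmu ((lt_aleph0_of_finite _).le.trans hmu) (ciSup_le' fun q => ?_)))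
    refine (mk_iUnion_le _).trans (mul_le_of_le hmu (hS q.1) (ciSup_le' fun v => ?_))
    exact (lt_aleph0_of_finite _).le.trans hmu
  obtain ⟨X, hX, hfree⟩ := h F fun w _ =>
    ⟨Order.lt_succ_iff.2 (hF w), Set.disjoint_sdiff_left⟩
  let v : Fin (k + 1) → lam.ord.ToType := fun i => (X.equivFinOfCardEq hX).symm i
  have hv : Function.Injective v :=
    Subtype.val_injective.comp (X.equivFinOfCardEq hX).symm.injective
  have hvX : ∀ i, v i ∈ X := fun i => ((X.equivFinOfCardEq hX).symm i).2
  refine ⟨v, fun j hj => ?_⟩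
  have hd := hfree (Finset.univ.image (v ∘ j.succAbove)) (by
      intro a ha
      obtain ⟨i, -, rfl⟩ := Finset.mem_image.1 ha
      exact hvX _) (by
      rw [Finset.card_image_of_injective _ (hv.comp Fin.succAbove_right_injective)]
      simp)
  have hjF : v j ∈ F (Finset.univ.image (v ∘ j.succAbove)) := by
    refine ⟨Set.mem_iUnion.2 ⟨⟨face v j, fun i =>
      Finset.mem_image_of_mem _ (Finset.mem_univ i)⟩, Set.mem_iUnion.2 ⟨⟨v, hj⟩, j, rfl⟩⟩, ?_⟩
    intro hmem
    obtain ⟨i, -, hi⟩ := Finset.mem_image.1 (Finset.mem_coe.1 hmem)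
    exact Fin.succAbove_ne j i (hv hi)
  exact Set.disjoint_left.1 hd hjF (hvX j)

theorem mk_faceIndex {k : ℕ} (hk : 1 ≤ k) {α : Type u} (hα : ℵ₀ ≤ #α) :
    #(Fin (k + 1) × (Fin k → α)) = #α := by
  rw [mk_prod, mk_pi, prod_const]
  simp only [lift_uzero, mk_fin, lift_natCast, power_natCast]
  rw [power_nat_eq hα hk]
  exact mul_eq_right hα ((natCast_lt_aleph0).le.trans hα) (by simp)

/-- No ultrafilter on the completion is moral if the set mapping relation holds: a multiplicative
refinement of the pattern of the generic `(k+1)`-partite hypergraph is determined by its values at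
faces, which have small supports, while the value at the set of faces of a tuple is disjoint from
the piece of a partition which belongs to that tuple alone. -/
theorem not_isMoral_of_setMappingArrow {k : ℕ} (hk : 1 ≤ k) {lam mu : Cardinal.{u}}
    (hlam : ℵ₀ ≤ lam) (hmu : ℵ₀ ≤ mu) (h : SetMappingArrow lam k (Order.succ mu) (k + 1))
    {T : (hypLang k).Theory} (hT : IsModelCompletion (hypTheory (k + 1) k) T)
    {A M : Type u} (hA : lam ≤ #A) (hM : #M = mu)
    {D : Order.PFilter (BoolCompletion (CylAlg A M))} (hD : IsUltra D) : ¬ IsMoral lam T D := by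
  classical
  intro hmoral
  have hM' : Infinite M := infinite_iff.2 (hM ▸ hmu)
  have hlam' : ℵ₀ ≤ #lam.ord.ToType := by rwa [mk_ord_toType]
  have : Infinite lam.ord.ToType := infinite_iff.2 hlam'
  obtain ⟨π⟩ : Nonempty (lam.ord.ToType ≃ Fin (k + 1) × (Fin k → lam.ord.ToType)) :=
    Cardinal.eq.1 (mk_faceIndex hk hlam').symm
  -- each tuple gets a partition of its own
  obtain ⟨a⟩ : Nonempty ((Fin (k + 1) → lam.ord.ToType) ↪ A) := by
    rw [← Cardinal.le_def, mk_pi, prod_const]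
    simp only [lift_uzero, mk_fin, lift_natCast, power_natCast]
    rw [mk_ord_toType]
    exact (power_nat_le hlam).trans hA
  choose η hη using exists_basic_compl_mem hD
  let e : (Fin (k + 1) → lam.ord.ToType) → BoolCompletion (CylAlg A M) :=
    fun v => basic {a v} (η (a v))
  have hinf : ∀ (s : Finset (Fin (k + 1) → lam.ord.ToType)), s.inf (fun v => (e v)ᶜ) ∈ D :=
    fun s => Finset.inf_induction (p := (· ∈ D)) D.top_mem (fun _ hx _ hy => D.inf_mem hx hy)
      fun v _ => hη _
  have hmem : ∀ u, indepValue hk π e u ∈ D := fun u => hinf _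
  obtain ⟨b', hmul, hle, hb'⟩ := hmoral _ _ (fun _ => Set.mem_univ _)
    (isPossibility_indepValue hk hT π e fun u hu => hD.1 (hu ▸ hmem u)) hmem
  choose S hS hSb using fun q => exists_support mu hmu hM.le (b' {q})
  obtain ⟨v, hv⟩ := exists_tuple_avoiding hmu h (fun q => a ⁻¹' S (π.symm q)) fun q =>
    (mk_preimage_of_injective _ _ a.injective).trans (hS _)
  let u := Finset.univ.image fun j => π.symm (face v j)
  have hu : NotDependsOn (a v) (b' u) := by
    rw [← inf_singleton_eq_of_multiplicative hmul (Finset.univ_nonempty.image _)]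
    refine NotDependsOn.finset_inf _ _ fun i hi => ?_
    obtain ⟨j, -, rfl⟩ := Finset.mem_image.1 hi
    exact hSb _ _ (hv j)
  refine hu.not_disjoint (fun hbot => hD.1 (hbot ▸ hb' u)) (η (a v)) ?_
  rw [← le_compl_iff_disjoint_right]
  exact (hle u).trans (indepValue_faces hk π e v).le

end MoralHyp

theorem claim4p1 (k : ℕ) (hk : 2 ≤ k) (lam mu : Cardinal.{u}) (hlam : ℵ₀ ≤ lam) (hmu : ℵ₀ ≤ mu)
    (h : (∃ (α : Ordinal.{u}) (l : ℕ), k < l ∧ mu = ℵ_ α ∧ lam = ℵ_ (α + (l : Ordinal.{u}))) ∨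
      MoralHyp.SetMappingArrow lam k (Order.succ mu) (k + 1))
    (T : (MoralHyp.hypLang k).Theory)
    (hT : MoralHyp.IsModelCompletion (MoralHyp.hypTheory (k + 1) k) T)
    (D : Order.PFilter (MoralHyp.B1 ((2 : Cardinal.{u}) ^ lam).ord mu)) (hD : MoralHyp.IsUltra D) :
    ¬ MoralHyp.IsMoral lam T D := by
  refine MoralHyp.not_isMoral_of_setMappingArrow (by omega) hlam hmu ?_ hT ?_
    (Cardinal.mk_ord_toType mu) hD
  · rcases h with ⟨α, l, hl, rfl, rfl⟩ | h
    · exact MoralHyp.setMappingArrow_aleph k α l hl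
    · exact h
  · rw [Cardinal.mk_ord_toType]
    exact (Cardinal.cantor lam).le
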